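/- Let $\widetilde{M}_2(5)$ be the affine variety over $\mathbb{Q}$ parametrising the tuples $(f,p_1,\dots,p_5)$, where $f:\mathbb{P}^1\to\mathbb{P}^1$ is an endomorphism of degree $2$ and $p_1,\dots,p_5\in\mathbb{P}^1$ are pairwise distinct points such that $f(p_i)=p_{i+1}$ for $1\le i\le 4$ and $f(p_5)=p_1$; it is a locally closed subvariety of $\mathbb{P}^5\times(\mathbb{P}^1)^5$, where the endomorphism $[u:v]\mapsto[a_0u^2+a_1uv+a_2v^2:a_3u^2+a_4uv+a_5v^2]$ corresponds to $(a_0:\dots:a_5)\in\mathbb{P}^5$. The group $\mathrm{PGL}_2$ acts on it by $g\cdot(f,p_1,\dots,p_5)=(gfg^{-1},g(p_1),\dots,g(p_5))$. Let $M_2(5)=\widetilde{M}_2(5)/\mathrm{PGL}_2$ be the quotient, an affine surface over $\mathbb{Q}$ whose coordinate ring is the ring of $\mathrm{PGL}_2$-invariant regular functions on $\widetilde{M}_2(5)$, and let $\sigma_5$ be the automorphism of $M_2(5)$ that sends the class of $(f,p_1,p_2,p_3,p_4,p_5)$ to the class of $(f,p_2,p_3,p_4,p_5,p_1)$. Then the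 quotient surface $M_2(5)/\langle\sigma_5\rangle$ is rational over $\mathbb{Q}$, that is, birational over $\mathbb{Q}$ to the affine plane $\mathbb{A}^2_{\mathbb{Q}}$. -/

import Mathlib

open scoped LinearAlgebra.Projectivization MatrixGroups

noncomputable section

namespace PeriodFive

/-!
Varieties over `ℚ` are described classically: a (reduced) variety is given by its points over the
algebraic closure `K` of `ℚ`, and its regular functions are the `K`-valued functions on these
points that are Zariski-locally quotients of polynomials with coefficients in `ℚ`.
-/

/-- The algebraic closure of `ℚ`. -/
abbrev K : Type := AlgebraicClosure ℚ

/-- The points of the projective line. -/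
abbrev P1 : Type := ℙ K (Fin 2 → K)

/-- The pair of binary quadratic forms
`(a₀ u² + a₁ u v + a₂ v², a₃ u² + a₄ u v + a₅ v²)`, evaluated at `w = (u, v)`. -/
def quad (a : Fin 6 → K) (w : Fin 2 → K) : Fin 2 → K :=
  ![a 0 * w 0 ^ 2 + a 1 * w 0 * w 1 + a 2 * w 1 ^ 2,
    a 3 * w 0 ^ 2 + a 4 * w 0 * w 1 + a 5 * w 1 ^ 2]

/-- The points of the variety of endomorphisms of degree `2` of the projective line: the points
`(a₀ : ⋯ : a₅)` of `ℙ⁵` for which the two quadratic forms have no common root. -/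
def End2 : Type :=
  {a : ℙ K (Fin 6 → K) // ∀ w : Fin 2 → K, w ≠ 0 → quad a.rep w ≠ 0}

/-- The map on points of an endomorphism of degree `2`. As `quad` is homogeneous in both arguments,
the value does not depend on the chosen representatives. -/
def End2.eval (f : End2) (q : P1) : P1 :=
  Projectivization.mk K (quad f.1.rep q.rep) (f.2 _ q.rep_nonzero)

/-- The points of `M̃₂(5)`: tuples `(f, p₁, …, p₅)` where `f` is an endomorphism of degree `2` of the
projective line and `p₁, …, p₅` are distinct points with `f(pᵢ) = pᵢ₊₁` and `f(p₅) = p₁`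
(the indices lie in `Fin 5`, where addition is cyclic). -/
@[ext]
structure MTilde : Type where
  /-- the endomorphism -/
  f : End2
  /-- the five points of the cycle -/
  p : Fin 5 → P1
  inj : Function.Injective p
  cycle : ∀ i, f.eval (p i) = p (i + 1)

/-- The points `x` and `y` of `M̃₂(5)` lie in the same orbit of `PGL₂`, which acts by
`g · (f, p₁, …, p₅) = (g ∘ f ∘ g⁻¹, g(p₁), …, g(p₅))`. -/
def SameOrbit (x y : MTilde) : Prop :=
  ∃ g : PGL(Fin 2, K), (∀ q, y.f.eval (g • q) = g • x.f.eval q) ∧ ∀ i, y.p i = g • x.p i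

/-- The cyclic shift `(f, p₁, p₂, …, p₅) ↦ (f, p₂, …, p₅, p₁)`. -/
def shift (x : MTilde) : MTilde where
  f := x.f
  p i := x.p (i + 1)
  inj := x.inj.comp (add_left_injective 1)
  cycle i := x.cycle (i + 1)

/-- The index set of the homogeneous coordinates on `ℙ⁵ × (ℙ¹)⁵`. -/
abbrev Coord : Type := Fin 6 ⊕ (Fin 5 × Fin 2)

/-- The multidegrees of the homogeneous coordinates on `ℙ⁵ × (ℙ¹)⁵`. -/
def multideg : Coord → ℕ × (Fin 5 → ℕ)
  | .inl _ => (1, 0)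
  | .inr (i, _) => (0, Pi.single i 1)

/-- Homogeneous coordinates of a point of `M̃₂(5) ⊆ ℙ⁵ × (ℙ¹)⁵`. -/
def MTilde.coord (x : MTilde) : Coord → K
  | .inl j => x.f.1.rep j
  | .inr (i, k) => (x.p i).rep k

/-- The function `h` on `M̃₂(5)` is regular over `ℚ` at `x`: on a Zariski open neighbourhood of `x`
it is the quotient of two multihomogeneous polynomials over `ℚ` of the same multidegree. -/
def IsRegularAt (h : MTilde → K) (x : MTilde) : Prop :=
  ∃ (m : ℕ × (Fin 5 → ℕ)) (P Q : MvPolynomial Coord ℚ),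
    P.IsWeightedHomogeneous multideg m ∧ Q.IsWeightedHomogeneous multideg m ∧
    MvPolynomial.aeval x.coord Q ≠ 0 ∧
    ∀ y : MTilde, MvPolynomial.aeval y.coord Q ≠ 0 →
      h y = MvPolynomial.aeval y.coord P / MvPolynomial.aeval y.coord Q

/-- The coordinate ring of the affine `ℚ`-variety `M̃₂(5)`: the functions that are regular over `ℚ`
at every point. -/
def coordRingMTilde : Subalgebra ℚ (MTilde → K) where
  carrier := {h | ∀ x, IsRegularAt h x}
  mul_mem' := by
    intro h₁ h₂ H₁ H₂ x
    obtain ⟨m₁, P₁, Q₁, hP₁, hQ₁, hx₁, e₁⟩ := H₁ x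
    obtain ⟨m₂, P₂, Q₂, hP₂, hQ₂, hx₂, e₂⟩ := H₂ x
    refine ⟨m₁ + m₂, P₁ * P₂, Q₁ * Q₂, hP₁.mul hP₂, hQ₁.mul hQ₂, ?_, ?_⟩
    · rw [map_mul]; exact mul_ne_zero hx₁ hx₂
    · intro y hy
      rw [map_mul] at hy
      rw [Pi.mul_apply, e₁ y (left_ne_zero_of_mul hy), e₂ y (right_ne_zero_of_mul hy), map_mul,
        map_mul, div_mul_div_comm]
  add_mem' := by
    intro h₁ h₂ H₁ H₂ x
    obtain ⟨m₁, P₁, Q₁, hP₁, hQ₁, hx₁, e₁⟩ := H₁ x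
    obtain ⟨m₂, P₂, Q₂, hP₂, hQ₂, hx₂, e₂⟩ := H₂ x
    refine ⟨m₁ + m₂, P₁ * Q₂ + Q₁ * P₂, Q₁ * Q₂, (hP₁.mul hQ₂).add (hQ₁.mul hP₂), hQ₁.mul hQ₂,
      ?_, ?_⟩
    · rw [map_mul]; exact mul_ne_zero hx₁ hx₂
    · intro y hy
      rw [map_mul] at hy
      rw [Pi.add_apply, e₁ y (left_ne_zero_of_mul hy), e₂ y (right_ne_zero_of_mul hy),
        div_add_div _ _ (left_ne_zero_of_mul hy) (right_ne_zero_of_mul hy)]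
      simp only [map_mul, map_add]
  algebraMap_mem' := by
    intro r x
    refine ⟨0, MvPolynomial.C r, 1, MvPolynomial.isWeightedHomogeneous_C _ _,
      MvPolynomial.isWeightedHomogeneous_one _ _, ?_, ?_⟩
    · rw [map_one]; exact one_ne_zero
    · intro y _
      rw [map_one, div_one, MvPolynomial.algHom_C]
      rfl

/-- The coordinate ring of the affine variety `M₂(5) = M̃₂(5) / PGL₂`: the regular functions on
`M̃₂(5)` that are constant on the orbits of `PGL₂`. (The regular functions on a geometric quotient
are the invariant regular functions upstairs.) -/
def coordRingM : Subalgebra ℚ (MTilde → K) where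
  carrier := {h | h ∈ coordRingMTilde ∧ ∀ x y, SameOrbit x y → h x = h y}
  mul_mem' := fun H₁ H₂ ↦ ⟨mul_mem H₁.1 H₂.1, fun x y r ↦
    congrArg₂ (· * ·) (H₁.2 x y r) (H₂.2 x y r)⟩
  add_mem' := fun H₁ H₂ ↦ ⟨add_mem H₁.1 H₂.1, fun x y r ↦
    congrArg₂ (· + ·) (H₁.2 x y r) (H₂.2 x y r)⟩
  algebraMap_mem' := fun r ↦ ⟨algebraMap_mem _ r, fun _ _ _ ↦ rfl⟩

/-- The effect of the shift on the homogeneous coordinates. -/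
def shiftCoord : Coord → Coord
  | .inl j => .inl j
  | .inr (i, k) => .inr (i + 1, k)

theorem coord_shift (x : MTilde) : (shift x).coord = x.coord ∘ shiftCoord := by
  funext c
  rcases c with j | ⟨i, k⟩ <;> rfl

/-- The effect of the shift on multidegrees. -/
def shiftDeg : (ℕ × (Fin 5 → ℕ)) →+ (ℕ × (Fin 5 → ℕ)) where
  toFun m := (m.1, fun i ↦ m.2 (i - 1))
  map_zero' := rfl
  map_add' _ _ := rfl

theorem multideg_shiftCoord (c : Coord) : multideg (shiftCoord c) = shiftDeg (multideg c) := by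
  rcases c with j | ⟨i, k⟩
  · rfl
  · refine Prod.ext rfl (funext fun l ↦ ?_)
    simp [multideg, shiftCoord, shiftDeg, Pi.single_apply, sub_eq_iff_eq_add]

theorem isWeightedHomogeneous_shift {P : MvPolynomial Coord ℚ} {m : ℕ × (Fin 5 → ℕ)}
    (hP : P.IsWeightedHomogeneous multideg m) :
    (MvPolynomial.rename shiftCoord P).IsWeightedHomogeneous multideg (shiftDeg m) := by
  classical
  intro d hd
  obtain ⟨u, rfl, hu⟩ := MvPolynomial.coeff_rename_ne_zero _ _ _ hd
  rw [← hP hu, Finsupp.weight_apply, Finsupp.weight_apply,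
    Finsupp.sum_mapDomain_index (by simp) (by intros; rw [add_smul]), map_finsuppSum]
  simp only [multideg_shiftCoord, map_nsmul]

theorem comp_shift_mem {h : MTilde → K} (H : h ∈ coordRingM) : h ∘ shift ∈ coordRingM := by
  refine ⟨fun x ↦ ?_, fun x y r ↦ ?_⟩
  · obtain ⟨m, P, Q, hP, hQ, hx, e⟩ := H.1 (shift x)
    refine ⟨shiftDeg m, MvPolynomial.rename shiftCoord P, MvPolynomial.rename shiftCoord Q,
      isWeightedHomogeneous_shift hP, isWeightedHomogeneous_shift hQ, ?_, fun y hy ↦ ?_⟩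
    · rwa [MvPolynomial.aeval_rename, ← coord_shift]
    · rw [MvPolynomial.aeval_rename, ← coord_shift] at hy ⊢
      rw [MvPolynomial.aeval_rename, ← coord_shift]
      exact e _ hy
  · obtain ⟨g, hf, hp⟩ := r
    exact H.2 _ _ ⟨g, hf, fun i ↦ hp (i + 1)⟩

/-- The comorphism `h ↦ h ∘ σ₅` of the automorphism `σ₅` of `M₂(5)` that sends the class of
`(f, p₁, p₂, …, p₅)` to the class of `(f, p₂, …, p₅, p₁)`. -/
def sigmaStar : coordRingM →ₐ[ℚ] coordRingM where
  toFun h := ⟨h.1 ∘ shift, comp_shift_mem h.2⟩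
  map_one' := rfl
  map_mul' _ _ := rfl
  map_zero' := rfl
  map_add' _ _ := rfl
  commutes' _ := rfl

/-- The coordinate ring of the quotient of the affine variety `M₂(5)` by the finite cyclic group
generated by `σ₅`: the functions on `M₂(5)` that are fixed by `σ₅`. -/
def coordRingQuotient : Subalgebra ℚ coordRingM :=
  AlgHom.equalizer sigmaStar (AlgHom.id ℚ coordRingM)

open AlgebraicGeometry CategoryTheory

/-- The quotient surface `M₂(5) / ⟨σ₅⟩` of the affine variety `M₂(5) = Spec coordRingM`, as a scheme:
the spectrum of the ring of `σ₅`-invariant functions. -/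
def MQuotient : Scheme.{0} := Spec (CommRingCat.of coordRingQuotient)

/-- The structure morphism of `M₂(5) / ⟨σ₅⟩` over `ℚ`. -/
def MQuotient.toSpecRat : MQuotient ⟶ Spec (CommRingCat.of ℚ) :=
  Spec.map (CommRingCat.ofHom (algebraMap ℚ coordRingQuotient))

end PeriodFive

end

/-!
The five cross-ratios `W i` of consecutive quadruples of points of the cycle satisfy the pentagon
relation `W i * W (i + 2) = 1 + W (i + 1)` when indexed so that `σ₅` acts on them by the rotation
`W i ↦ W (i + 3)`. A point of `M₂(5)` is determined by its cross-ratios: normalizing three of the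
five points to `1`, `∞` and `0`, the conditions `f(pᵢ) = pᵢ₊₁` are linear equations for the
coefficients of `f` with a unique solution up to scaling, and its resultant vanishes only on the
curve `∏ W i * ∏ (W i - W (i + 1)) = 0`. Hence the coordinate ring of `M₂(5)` is obtained from the
polynomials in the cross-ratios by inverting this product.

The rotation-invariant polynomials in the cross-ratios are generated by the sums `S = ∑ W i` and
`P = ∑ W i * W (i + 1)` and by `Y = ∏ (W i - W (i + 1))`, and `Y ^ 2 = F(S, P)` is a cubic
polynomial in `P`. The branch curve `F = 0` of this double plane has two conjugate tacnodes over
`S ^ 2 - 5 * S - 25 = 0`: for a suitable `U` that is linear in `P`, `F` is a combination of `U ^ 3`,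
`U ^ 2`, `U * (S ^ 2 - 5 * S - 25) ^ 2` and `(S ^ 2 - 5 * S - 25) ^ 4` over `ℚ[S]`. With
`25 * V = (S + 10) * U - (S ^ 2 - 5 * S - 25) ^ 2`, the relation between `u = U / Y`, `v = V / Y`
and `S` is linear in `S`, so that `S`, `P` and `Y` are rational functions of `u` and `v`.
-/

noncomputable section

namespace PeriodFive

/-! ### Lyness cycles -/

section Lyness

theorem sum_eq_of_fin_five {M : Type*} [AddCommMonoid M] (F : Fin 5 → M) (i : Fin 5) :
    ∑ j, F j = F i + F (i + 1) + F (i + 2) + F (i + 3) + F (i + 4) := by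
  rw [← Equiv.sum_comp (Equiv.addLeft i) F, Fin.sum_univ_five]
  simp only [Equiv.coe_addLeft, add_zero]

variable {R : Type*} [CommRing R]

/-- A cycle of length five of the Lyness recurrence `W (i + 2) = (1 + W (i + 1)) / W i`, with the
denominators cleared. -/
def IsLyness (W : Fin 5 → R) : Prop := ∀ i, W i * W (i + 2) = 1 + W (i + 1)

/-- The invariant `∑ Wᵢ` of a cycle under cyclic shifts. -/
def cycS (W : Fin 5 → R) : R := ∑ i, W i

/-- The invariant `∑ Wᵢ Wᵢ₊₁` of a cycle under cyclic shifts. -/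
def cycP (W : Fin 5 → R) : R := ∑ i, W i * W (i + 1)

/-- The invariant `∑ Wᵢ² Wᵢ₊₁` of a cycle under cyclic shifts. -/
def cycQ (W : Fin 5 → R) : R := ∑ i, W i ^ 2 * W (i + 1)

/-- The invariant `∏ (Wᵢ - Wᵢ₊₁)` of a cycle under cyclic shifts, which changes sign when the cycle
is reversed. -/
def cycY (W : Fin 5 → R) : R := ∏ i, (W i - W (i + 1))

variable {W : Fin 5 → R}

namespace IsLyness

theorem relations (h : IsLyness W) (i : Fin 5) :
    W i * W (i + 2) = 1 + W (i + 1) ∧ W (i + 1) * W (i + 3) = 1 + W (i + 2) ∧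
      W (i + 2) * W (i + 4) = 1 + W (i + 3) ∧ W (i + 3) * W i = 1 + W (i + 4) ∧
      W (i + 4) * W (i + 1) = 1 + W i := by
  have h1 := h (i + 1)
  have h2 := h (i + 2)
  have h3 := h (i + 3)
  have h4 := h (i + 4)
  simp only [add_assoc, Fin.reduceAdd, add_zero] at h1 h2 h3 h4
  exact ⟨h i, h1, h2, h3, h4⟩

theorem prod_eq (h : IsLyness W) : ∏ i, W i = cycS W + 3 := by
  obtain ⟨r0, r1, r2, -, r4⟩ := h.relations 0
  rw [Fin.prod_univ_five, cycS, Fin.sum_univ_five]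
  grind

theorem cycQ_add_reverse (h : IsLyness W) :
    cycQ W + ∑ i, W i * W (i + 1) ^ 2 =
      cycS W * cycP W - 2 * cycS W ^ 2 + 4 * cycP W + 15 := by
  obtain ⟨r0, r1, r2, r3, r4⟩ := h.relations 0
  simp only [cycS, cycP, cycQ, Fin.sum_univ_five, Fin.reduceAdd]
  grind

theorem cycQ_mul_reverse (h : IsLyness W) :
    cycQ W * ∑ i, W i * W (i + 1) ^ 2 =
      cycP W ^ 3 + (14 * cycS W + 39) * cycP W ^ 2 +
      (-8 * cycS W ^ 3 - 16 * cycS W ^ 2 + 100 * cycS W + 230) * cycP W +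
      (cycS W ^ 5 + 2 * cycS W ^ 4 - 26 * cycS W ^ 3 - 55 * cycS W ^ 2 + 175 * cycS W + 400) := by
  obtain ⟨r0, r1, r2, r3, r4⟩ := h.relations 0
  simp only [cycS, cycP, cycQ, Fin.sum_univ_five, Fin.reduceAdd]
  grind

theorem cycY_eq_sub (h : IsLyness W) : cycY W = cycQ W - ∑ i, W i * W (i + 1) ^ 2 := by
  obtain ⟨r0, r1, r2, -, r4⟩ := h.relations 0
  simp only [cycQ, cycY, Fin.sum_univ_five, Fin.prod_univ_five, Fin.reduceAdd]
  grind

theorem cycY_eq (h : IsLyness W) :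
    cycY W = 2 * cycQ W - (cycS W * cycP W - 2 * cycS W ^ 2 + 4 * cycP W + 15) := by
  linear_combination h.cycY_eq_sub - h.cycQ_add_reverse

theorem sq_eq (h : IsLyness W) (i : Fin 5) :
    W i ^ 2 = cycS W * W i - W i * W (i + 1) - W (i + 4) * W i - W (i + 1) - W (i + 4) - 1 -
      1 := by
  obtain ⟨r0, -, -, r3, -⟩ := h.relations i
  rw [cycS, sum_eq_of_fin_five W i]
  grind

theorem sq_mul_sub_eq (h : IsLyness W) (i : Fin 5) :
    W i ^ 2 * W (i + 1) - W (i + 4) ^ 2 * W i = cycP W * W i - cycS W * (W (i + 4) * W i) +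
      W i ^ 2 - W (i + 1) ^ 2 + 2 * W i + W (i + 4) - W (i + 1) - W (i + 2) - W (i + 3) := by
  obtain ⟨r0, r1, -, -, r4⟩ := h.relations i
  rw [cycP, cycS, sum_eq_of_fin_five W i, sum_eq_of_fin_five (fun i ↦ W i * W (i + 1)) i]
  simp only [add_assoc, Fin.reduceAdd, add_zero]
  grind

end IsLyness

variable [Algebra ℚ R]

/-- The algebra generated by the invariants `S`, `P` and `Q` of a cycle. -/
def cycAlgebra (W : Fin 5 → R) : Subalgebra ℚ R :=
  Algebra.adjoin ℚ {cycS W, cycP W, cycQ W}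

theorem cycS_mem_cycAlgebra : cycS W ∈ cycAlgebra W := Algebra.subset_adjoin (by simp)

theorem cycP_mem_cycAlgebra : cycP W ∈ cycAlgebra W := Algebra.subset_adjoin (by simp)

theorem cycQ_mem_cycAlgebra : cycQ W ∈ cycAlgebra W := Algebra.subset_adjoin (by simp)

/-- The module spanned over `cycAlgebra W` by `1`, the members of the cycle and the products of
neighbours. -/
def cycModule (W : Fin 5 → R) : Submodule (cycAlgebra W) R :=
  Submodule.span (cycAlgebra W) ({1} ∪ Set.range W ∪ Set.range fun i ↦ W i * W (i + 1))

theorem smul_mem_cycModule {c m : R} (hc : c ∈ cycAlgebra W) (hm : m ∈ cycModule W) :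
    c * m ∈ cycModule W :=
  (cycModule W).smul_mem (⟨c, hc⟩ : cycAlgebra W) hm

theorem one_mem_cycModule : (1 : R) ∈ cycModule W :=
  Submodule.subset_span (Or.inl (Or.inl rfl))

theorem mem_cycModule (i : Fin 5) : W i ∈ cycModule W :=
  Submodule.subset_span (Or.inl (Or.inr ⟨i, rfl⟩))

theorem mul_succ_mem_cycModule (i : Fin 5) : W i * W (i + 1) ∈ cycModule W :=
  Submodule.subset_span (Or.inr ⟨i, rfl⟩)

theorem pred_mul_mem_cycModule (i : Fin 5) : W (i + 4) * W i ∈ cycModule W := by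
  simpa only [add_assoc, Fin.reduceAdd, add_zero] using mul_succ_mem_cycModule (W := W) (i + 4)

theorem cycS_mul_mem_cycModule {m : R} (hm : m ∈ cycModule W) : cycS W * m ∈ cycModule W :=
  smul_mem_cycModule cycS_mem_cycAlgebra hm

theorem cycP_mul_mem_cycModule {m : R} (hm : m ∈ cycModule W) : cycP W * m ∈ cycModule W :=
  smul_mem_cycModule cycP_mem_cycAlgebra hm

theorem cycQ_mem_cycModule : cycQ W ∈ cycModule W := by
  simpa only [mul_one] using smul_mem_cycModule (W := W) cycQ_mem_cycAlgebra one_mem_cycModule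

theorem ofNat_mul_mem_cycModule (n : ℕ) [n.AtLeastTwo] {m : R} (hm : m ∈ cycModule W) :
    ofNat(n) * m ∈ cycModule W :=
  smul_mem_cycModule (ofNat_mem _ n) hm

namespace IsLyness

theorem sq_mem_cycModule (h : IsLyness W) (i : Fin 5) : W i ^ 2 ∈ cycModule W := by
  rw [h.sq_eq i]
  apply_rules [sub_mem, mem_cycModule, mul_succ_mem_cycModule, pred_mul_mem_cycModule,
    one_mem_cycModule, cycS_mul_mem_cycModule]

theorem sq_mul_sub_mem_cycModule (h : IsLyness W) (i : Fin 5) :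
    W i ^ 2 * W (i + 1) - W (i + 4) ^ 2 * W i ∈ cycModule W := by
  rw [h.sq_mul_sub_eq i]
  apply_rules [sub_mem, add_mem, h.sq_mem_cycModule, mem_cycModule, pred_mul_mem_cycModule,
    ofNat_mul_mem_cycModule, cycP_mul_mem_cycModule, cycS_mul_mem_cycModule]

theorem sq_mul_mem_cycModule (h : IsLyness W) (i : Fin 5) :
    W i ^ 2 * W (i + 1) ∈ cycModule W := by
  have hsub := h.sq_mul_sub_mem_cycModule
  have h0 := hsub i
  have h4 := hsub (i + 4)
  have h3 := hsub (i + 3)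
  have h2 := hsub (i + 2)
  simp only [add_assoc, Fin.reduceAdd, add_zero] at h2 h3 h4
  have hsum : (5 : ℚ) • (W i ^ 2 * W (i + 1)) = cycQ W +
      4 * (W i ^ 2 * W (i + 1) - W (i + 4) ^ 2 * W i) +
      3 * (W (i + 4) ^ 2 * W i - W (i + 3) ^ 2 * W (i + 4)) +
      2 * (W (i + 3) ^ 2 * W (i + 4) - W (i + 2) ^ 2 * W (i + 3)) +
      (W (i + 2) ^ 2 * W (i + 3) - W (i + 1) ^ 2 * W (i + 2)) := by
    rw [cycQ, sum_eq_of_fin_five (fun i ↦ W i ^ 2 * W (i + 1)) i, ofNat_smul_eq_nsmul, nsmul_eq_mul]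
    simp only [add_assoc, Fin.reduceAdd, add_zero]
    push_cast
    ring
  have hmem : (5 : ℚ) • (W i ^ 2 * W (i + 1)) ∈ cycModule W := by
    rw [hsum]
    apply_rules [cycQ_mem_cycModule, add_mem, h0, h4, h3, h2, ofNat_mul_mem_cycModule]
  have hdiv := (cycModule W).smul_of_tower_mem (5⁻¹ : ℚ) hmem
  rwa [inv_smul_smul₀ (by norm_num)] at hdiv

theorem mul_mem_cycModule (h : IsLyness W) (i j : Fin 5) : W i * W j ∈ cycModule W := by
  obtain ⟨k, rfl⟩ : ∃ k, j = i + k := ⟨j - i, by abel⟩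
  obtain ⟨r0, -, -, r3, -⟩ := h.relations i
  fin_cases k
  · simpa [sq] using h.sq_mem_cycModule i
  · exact mul_succ_mem_cycModule i
  · exact r0 ▸ add_mem one_mem_cycModule (mem_cycModule _)
  · exact mul_comm (W i) _ ▸ r3 ▸ add_mem one_mem_cycModule (mem_cycModule _)
  · exact mul_comm (W i) _ ▸ pred_mul_mem_cycModule i

theorem mul_mul_succ_mem_cycModule (h : IsLyness W) (i j : Fin 5) :
    W i * (W j * W (j + 1)) ∈ cycModule W := by
  obtain ⟨k, rfl⟩ : ∃ k, j = i + k := ⟨j - i, by abel⟩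
  obtain ⟨r0, r1, r2, r3, r4⟩ := h.relations i
  have hsum := sum_eq_of_fin_five W i
  rw [← cycS] at hsum
  fin_cases k
  · have heq : W i * (W i * W (i + 1)) = W i ^ 2 * W (i + 1) := by ring
    simpa only [Fin.zero_eta, add_zero, heq] using! h.sq_mul_mem_cycModule i
  · have heq : W i * (W (i + 1) * W (i + 2)) = W (i + 1) + W (i + 1) ^ 2 := by grind
    simpa only [add_assoc, Fin.reduceAdd, Fin.mk_one, heq] using!
      add_mem (mem_cycModule (i + 1)) (h.sq_mem_cycModule (i + 1))
  · have heq : W i * (W (i + 2) * W (i + 3)) = W (i + 3) + W (i + 2) + 1 := by grind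
    simpa only [add_assoc, Fin.reduceAdd, Fin.reduceFinMk, heq] using!
      add_mem (add_mem (mem_cycModule (i + 3)) (mem_cycModule (i + 2))) one_mem_cycModule
  · have heq : W i * (W (i + 3) * W (i + 4)) = W (i + 4) + W (i + 4) ^ 2 := by grind
    simpa only [add_assoc, Fin.reduceAdd, Fin.reduceFinMk, heq] using!
      add_mem (mem_cycModule (i + 4)) (h.sq_mem_cycModule (i + 4))
  · have heq : W i * (W (i + 4) * W i) = cycS W * (W (i + 4) * W i) - W (i + 4) ^ 2 * W i -
        2 * W i - 2 * W (i + 4) - 1 - W i ^ 2 - W (i + 4) ^ 2 := by grind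
    have hcube := h.sq_mul_mem_cycModule (i + 4)
    simp only [add_assoc, Fin.reduceAdd, add_zero] at hcube
    simp only [add_assoc, Fin.reduceAdd, add_zero, Fin.reduceFinMk, heq]
    apply_rules [sub_mem, hcube, h.sq_mem_cycModule, mem_cycModule, one_mem_cycModule,
      pred_mul_mem_cycModule, ofNat_mul_mem_cycModule, cycS_mul_mem_cycModule]

theorem mul_mem_cycModule_of_mem (h : IsLyness W) (i : Fin 5) {m : R} (hm : m ∈ cycModule W) :
    W i * m ∈ cycModule W := by
  induction hm using Submodule.span_induction with
  | mem x hx =>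
    obtain (rfl | ⟨j, rfl⟩) | ⟨j, rfl⟩ := hx
    · simpa only [mul_one] using mem_cycModule i
    · exact h.mul_mem_cycModule i j
    · exact h.mul_mul_succ_mem_cycModule i j
  | zero => simp only [mul_zero, zero_mem]
  | add x y _ _ hx hy => simpa only [mul_add] using add_mem hx hy
  | smul c x _ hx => simpa only [mul_smul_comm] using Submodule.smul_mem _ c hx

theorem adjoin_le_cycModule (h : IsLyness W) :
    Subalgebra.toSubmodule (Algebra.adjoin ℚ (Set.range W)) ≤
      (cycModule W).restrictScalars ℚ := by
  intro r hr
  suffices hmul : ∀ m ∈ cycModule W, r * m ∈ cycModule W by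
    simpa only [mul_one] using! hmul 1 one_mem_cycModule
  induction hr using Algebra.adjoin_induction with
  | mem x hx =>
    obtain ⟨i, rfl⟩ := hx
    exact fun m ↦ h.mul_mem_cycModule_of_mem i
  | algebraMap c => exact fun m ↦ smul_mem_cycModule ((cycAlgebra W).algebraMap_mem c)
  | add x y _ _ hx hy => exact fun m hm ↦ by simpa only [add_mul] using add_mem (hx m hm) (hy m hm)
  | mul x y _ _ hx hy => exact fun m hm ↦ by simpa only [mul_assoc] using hx _ (hy m hm)

theorem isIntegral [IsDomain R] (h : IsLyness W) (i : Fin 5) :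
    IsIntegral (cycAlgebra W) (W i) :=
  isIntegral_of_smul_mem_submodule (cycModule W)
    (Submodule.ne_bot_iff _ |>.2 ⟨1, one_mem_cycModule, one_ne_zero⟩)
    (Submodule.fg_span (((Set.finite_singleton _).union (Set.finite_range _)).union
      (Set.finite_range _))) (W i) fun _ ↦ h.mul_mem_cycModule_of_mem i

end IsLyness

section Shift

variable {τ : R →ₐ[ℚ] R}

theorem map_eq_of_mem_cycAlgebra (hτ : ∀ i, τ (W i) = W (i + 3)) {c : R} (hc : c ∈ cycAlgebra W) :
    τ c = c := by
  suffices hle : cycAlgebra W ≤ AlgHom.equalizer τ (AlgHom.id ℚ R) from hle hc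
  have hsum (F : Fin 5 → R) : ∑ i, F (i + 3) = ∑ i, F i := Equiv.sum_comp (Equiv.addRight 3) F
  refine Algebra.adjoin_le ?_
  rintro _ (rfl | rfl | rfl)
  · simpa [cycS, hτ] using! hsum W
  · simpa [cycP, hτ, add_right_comm _ (1 : Fin 5)] using! hsum fun i ↦ W i * W (i + 1)
  · simpa [cycQ, hτ, add_right_comm _ (1 : Fin 5)] using! hsum fun i ↦ W i ^ 2 * W (i + 1)

theorem pow_shift_apply (hτ : ∀ i, τ (W i) = W (i + 3)) (n : ℕ) (i : Fin 5) :
    (τ ^ n) (W i) = W (i + n • 3) := by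
  induction n with
  | zero => simp only [pow_zero, AlgHom.one_apply, zero_smul, add_zero]
  | succ n ih => rw [pow_succ', AlgHom.mul_apply, ih, hτ, succ_nsmul, add_assoc]

theorem sum_pow_mem_cycAlgebra (hτ : ∀ i, τ (W i) = W (i + 3)) {m : R} (hm : m ∈ cycModule W) :
    ∑ k : Fin 5, (τ ^ (k : ℕ)) m ∈ cycAlgebra W := by
  have hsum (F : Fin 5 → R) (j : Fin 5) : ∑ k : Fin 5, F (j + (k : ℕ) • 3) = ∑ i, F i :=
    Function.Bijective.sum_comp (by revert j; decide) F
  induction hm using Submodule.span_induction with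
  | mem x hx =>
    obtain (rfl | ⟨j, rfl⟩) | ⟨j, rfl⟩ := hx
    · simp only [map_one]
      exact sum_mem fun _ _ ↦ one_mem _
    · simp only [pow_shift_apply hτ, hsum]
      exact Algebra.subset_adjoin (by simp [cycS])
    · simp only [map_mul, pow_shift_apply hτ, add_right_comm _ (1 : Fin 5),
        hsum fun i ↦ W i * W (i + 1)]
      exact Algebra.subset_adjoin (by simp [cycP])
  | zero => simp only [map_zero, Finset.sum_const_zero, zero_mem]
  | add x y _ _ hx hy => simpa only [map_add, Finset.sum_add_distrib] using add_mem hx hy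
  | smul c x _ hx =>
    have hfix (n : ℕ) : (τ ^ n) (c : R) = c := by
      rw [AlgHom.coe_pow]
      exact Function.iterate_fixed (map_eq_of_mem_cycAlgebra hτ c.2) n
    simpa only [Subalgebra.smul_def, smul_eq_mul, map_mul, hfix, ← Finset.mul_sum] using
      mul_mem c.2 hx

theorem IsLyness.mem_cycAlgebra_of_map_eq (h : IsLyness W) (hτ : ∀ i, τ (W i) = W (i + 3)) {r : R}
    (hr : r ∈ Algebra.adjoin ℚ (Set.range W)) (hfix : τ r = r) : r ∈ cycAlgebra W := by
  have htrace := sum_pow_mem_cycAlgebra hτ (h.adjoin_le_cycModule hr)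
  have hpow (n : ℕ) : (τ ^ n) r = r := by
    rw [AlgHom.coe_pow]
    exact Function.iterate_fixed hfix n
  simp only [hpow, Finset.sum_const, Finset.card_univ, Fintype.card_fin] at htrace
  have hdiv := (cycAlgebra W).smul_mem htrace (5⁻¹ : ℚ)
  rwa [← Nat.cast_smul_eq_nsmul ℚ, Nat.cast_ofNat, inv_smul_smul₀ (by norm_num)] at hdiv

end Shift

end Lyness

/-! ### Birationality to affine space -/

section Birational

open AlgebraicGeometry CategoryTheory

universe u

theorem isDominant_specMap {R S : Type u} [CommRing R] [CommRing S] {φ : R →+* S}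
    (hφ : Function.Injective φ) : IsDominant (Spec.map (CommRingCat.ofHom φ)) := by
  refine ⟨?_⟩
  change DenseRange (PrimeSpectrum.comap φ)
  rw [PrimeSpectrum.denseRange_comap_iff_ker_le_nilRadical,
    (RingHom.injective_iff_ker_eq_bot φ).1 hφ]
  exact bot_le

variable {k A ι : Type u} [Field k] [CommRing A] [IsDomain A] [Algebra k A]

theorem birationalOver_affineSpace_of_pow_mul_eq {φ : MvPolynomial ι k →ₐ[k] A}
    (hφ : Function.Injective φ) {c : MvPolynomial ι k} (hc : c ≠ 0)
    (h : ∀ a, ∃ (n : ℕ) (r : MvPolynomial ι k), φ c ^ n * a = φ r) :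
    Scheme.BirationalOver (Spec.map (CommRingCat.ofHom (algebraMap k A)))
      (𝔸(ι; Spec (CommRingCat.of k)) ↘ Spec (CommRingCat.of k)) := by
  let B := Localization.Away (φ c)
  have hφc : φ c ≠ 0 := by rwa [Ne, map_eq_zero_iff φ hφ]
  have hAB : Function.Injective (algebraMap A B) :=
    IsLocalization.injective B (powers_le_nonZeroDivisors_of_noZeroDivisors hφc)
  let : Algebra (MvPolynomial ι k) B := ((algebraMap A B).comp φ.toRingHom).toAlgebra
  have hmap (r) : algebraMap (MvPolynomial ι k) B r = algebraMap A B (φ r) := rfl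
  have hB : IsLocalization.Away c B := by
    refine IsLocalization.Away.mk c (IsLocalization.Away.algebraMap_isUnit (φ c)) (fun s ↦ ?_)
      fun a b hab ↦ ⟨0, by rw [hφ (hAB hab)]⟩
    obtain ⟨n, a, ha⟩ := IsLocalization.Away.surj (φ c) s
    obtain ⟨m, r, hr⟩ := h a
    refine ⟨n + m, r, ?_⟩
    rw [hmap, hmap, ← hr, map_mul, ← ha, map_pow]
    ring
  have := IsOpenImmersion.of_isLocalization (S := B) (φ c)
  have := IsOpenImmersion.of_isLocalization (S := B) c
  have := isDominant_specMap hAB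
  have := isDominant_specMap (φ := algebraMap (MvPolynomial ι k) B) (hAB.comp hφ)
  have hBA := Scheme.Hom.birationalOver (Spec.map (CommRingCat.ofHom (algebraMap A B)))
    (Spec.map (CommRingCat.ofHom (algebraMap k A))) _ rfl
  have hBAffine := Scheme.Hom.birationalOver
    (Spec.map (CommRingCat.ofHom (algebraMap (MvPolynomial ι k) B)) ≫
      (AffineSpace.SpecIso ι (CommRingCat.of k)).inv)
    (𝔸(ι; Spec (CommRingCat.of k)) ↘ Spec (CommRingCat.of k))
    (Spec.map (CommRingCat.ofHom (algebraMap A B)) ≫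
      Spec.map (CommRingCat.ofHom (algebraMap k A))) (by
        rw [Category.assoc, AffineSpace.SpecIso_inv_over, ← Spec.map_comp, ← Spec.map_comp]
        congr 1
        ext x
        simp [hmap])
  exact hBA.symm.trans hBAffine

open scoped Pointwise in
theorem exists_pow_mul_mem_of_mul_mem [Algebra.FiniteType k A] {T : Subalgebra k A}
    (hT : ∀ a, ∃ d ∈ T, d ≠ 0 ∧ d * a ∈ T) :
    ∃ c ∈ T, c ≠ 0 ∧ ∀ a, ∃ n : ℕ, c ^ n * a ∈ T := by
  classical
  choose d hdT hd0 hdmul using hT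
  obtain ⟨s, hs⟩ := Algebra.FiniteType.out (R := k) (A := A)
  refine ⟨∏ a ∈ s, d a, prod_mem fun a _ ↦ hdT a, Finset.prod_ne_zero_iff.2 fun a _ ↦ hd0 a,
    fun a ↦ ?_⟩
  have hsT : (∏ a ∈ s, d a) • (s : Set A) ⊆ (T : Set A) := by
    rintro _ ⟨a, ha, rfl⟩
    simp only [smul_eq_mul]
    rw [← Finset.prod_erase_mul s d ha, mul_assoc]
    exact mul_mem (prod_mem fun a _ ↦ hdT a) (hdmul a)
  obtain ⟨n, hn⟩ := Algebra.pow_smul_mem_of_smul_subset_of_mem_adjoin (∏ a ∈ s, d a) _ T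
    hsT (hs ▸ Algebra.mem_top : a ∈ _) (prod_mem fun a _ ↦ hdT a)
  exact ⟨n, hn n le_rfl⟩

theorem birationalOver_affineSpace {L : Type*} [Field L] [Algebra k L] [Algebra A L]
    [IsScalarTower k A L] [FaithfulSMul A L] [Algebra.FiniteType k A] {x : ι → A}
    (hx : AlgebraicIndependent k (algebraMap A L ∘ x))
    (hmem : ∀ a, algebraMap A L a ∈ IntermediateField.adjoin k (Set.range (algebraMap A L ∘ x))) :
    Scheme.BirationalOver (Spec.map (CommRingCat.ofHom (algebraMap k A)))
      (𝔸(ι; Spec (CommRingCat.of k)) ↘ Spec (CommRingCat.of k)) := by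
  have hinj := FaithfulSMul.algebraMap_injective A L
  have hφ : Function.Injective (MvPolynomial.aeval (R := k) x) :=
    algebraicIndependent_iff_injective_aeval.1
      (((IsScalarTower.toAlgHom k A L).algebraicIndependent_iff hinj).1 hx)
  have haeval (p : MvPolynomial ι k) : MvPolynomial.aeval (algebraMap A L ∘ x) p =
      algebraMap A L (MvPolynomial.aeval x p) := MvPolynomial.aeval_algebraMap_apply ..
  obtain ⟨_, ⟨c, rfl⟩, hc, hpow⟩ :=
      exists_pow_mul_mem_of_mul_mem (T := (MvPolynomial.aeval (R := k) x).range) fun a ↦ by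
    obtain ⟨r, s, hrs⟩ := (IntermediateField.mem_adjoin_range_iff k _ _).1 (hmem a)
    rw [haeval, haeval] at hrs
    by_cases hs : MvPolynomial.aeval x s = 0
    · rw [hs, map_zero, div_zero, map_eq_zero_iff _ hinj] at hrs
      exact ⟨1, one_mem _, one_ne_zero, by rw [hrs, mul_zero]; exact zero_mem _⟩
    · rw [eq_div_iff (by rwa [Ne, map_eq_zero_iff _ hinj]), ← map_mul] at hrs
      exact ⟨_, ⟨s, rfl⟩, hs, r, by rw [mul_comm]; exact (hinj hrs).symm⟩
  have hc0 : c ≠ 0 := fun h ↦ hc (by rw [h, map_zero])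
  refine birationalOver_affineSpace_of_pow_mul_eq hφ hc0 fun a ↦ ?_
  obtain ⟨n, r, hr⟩ := hpow a
  exact ⟨n, r, hr.symm⟩

end Birational

section Transcendence

theorem algebraicIndependent_of_isAlgebraic_adjoin {ι k L : Type*} [Finite ι] [Field k] [Field L]
    [Algebra k L] {x y : ι → L} (hy : AlgebraicIndependent k y)
    (h : ∀ i, IsAlgebraic (IntermediateField.adjoin k (Set.range x)) (y i)) :
    AlgebraicIndependent k x := by
  let M := AlgebraicIndependent.matroid k L
  have hyx : Set.range y ⊆ M.closure (Set.range x) := by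
    rw [AlgebraicIndependent.matroid_closure_eq]
    rintro _ ⟨i, rfl⟩
    exact IntermediateField.isAlgebraic_adjoin_iff.1 (h i)
  obtain ⟨B, hB⟩ := M.exists_isBasis (Set.range x)
  have hcard : Nat.card ι ≤ B.ncard := by
    rw [← Nat.card_range_of_injective hy.injective, Nat.card_coe_set_eq]
    refine ENat.toNat_le_toNat ?_ ((Set.finite_range x).subset hB.subset).encard_lt_top.ne
    rw [← hB.eRk_eq_encard, ← M.eRk_closure_eq]
    exact Matroid.Indep.encard_le_eRk_of_subset hy.to_subtype_range hyx
  have hBx : B = Set.range x := Set.eq_of_subset_of_ncard_le hB.subset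
    ((Nat.card_coe_set_eq _).symm.trans_le (Finite.card_range_le x) |>.trans hcard)
  have hinj : Function.Injective x := by
    have := (Set.rangeFactorization_surjective (f := x)).bijective_of_nat_card_le
      (by rwa [Nat.card_coe_set_eq, ← hBx])
    exact fun _ _ hij ↦ this.1 (Subtype.ext hij)
  exact (algebraicIndependent_subtype_range hinj).1 (hBx ▸ hB.indep)

theorem aeval_ne_zero_of_eval_ne_zero {ι k A : Type*} [CommRing k] [CommRing A] [Algebra k A]
    {x : ι → A} (hx : AlgebraicIndependent k x) {p : MvPolynomial ι k} {c : ι → k}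
    (hp : MvPolynomial.eval c p ≠ 0) : MvPolynomial.aeval x p ≠ 0 := fun h ↦
  hp (by rw [hx.eq_zero_of_aeval_eq_zero p h, map_zero])

theorem isDomain_of_algebraicIndependent {ι k A : Type*} [CommRing k] [IsDomain k] [CommRing A]
    [Algebra k A] {x : ι → A} (hx : AlgebraicIndependent k x)
    (h : ∀ a, ∃ c, IsUnit c ∧ c * a ∈ Algebra.adjoin k (Set.range x)) : IsDomain A := by
  have := hx.aevalEquiv.symm.toMulEquiv.isDomain
  have := (FaithfulSMul.algebraMap_injective (Algebra.adjoin k (Set.range x)) A).nontrivial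
  have : NoZeroDivisors A := ⟨fun {a b} hab ↦ by
    obtain ⟨c, hc, hca⟩ := h a
    obtain ⟨d, hd, hdb⟩ := h b
    have hmul : (⟨c * a, hca⟩ * ⟨d * b, hdb⟩ : Algebra.adjoin k (Set.range x)) = 0 :=
      Subtype.ext <| (mul_mul_mul_comm c a d b).trans <| by
        rw [hab, mul_zero, ZeroMemClass.coe_zero]
    refine (mul_eq_zero.1 hmul).imp (fun h0 ↦ ?_) fun h0 ↦ ?_
    exacts [hc.mul_right_eq_zero.1 (congrArg Subtype.val h0),
      hd.mul_right_eq_zero.1 (congrArg Subtype.val h0)]⟩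
  exact NoZeroDivisors.to_isDomain A

end Transcendence

/-! ### The double plane of the invariants -/

section DoublePlane

/-- The right-hand side of the equation `Y² = F(S, P)` of the quotient surface as a double plane. -/
def doublePlane {R : Type*} [CommRing R] (S P : R) : R :=
  -4 * P ^ 3 + (S ^ 2 - 48 * S - 140) * P ^ 2 + (28 * S ^ 3 + 48 * S ^ 2 - 370 * S - 800) * P +
    (-4 * S ^ 5 - 4 * S ^ 4 + 104 * S ^ 3 + 160 * S ^ 2 - 700 * S - 1375)

/-- The numerator of the first coordinate `u = numU / Y` on the double plane. -/
def numU {R : Type*} [CommRing R] (S P : R) : R :=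
  25 * P + S ^ 3 - 20 * S ^ 2 + 25 * S + 250

/-- The numerator of the second coordinate `v = numV / Y` on the double plane. -/
def numV {R : Type*} [CommRing R] (S P : R) : R :=
  (S + 10) * P - 6 * S ^ 2 + 10 * S + 75

section CommRing

variable {R : Type*} [CommRing R] (S P : R)

section Map

variable {R' F : Type*} [CommRing R'] [FunLike F R R'] [RingHomClass F R R'] (f : F)

theorem map_doublePlane : f (doublePlane S P) = doublePlane (f S) (f P) := by
  simp only [doublePlane, map_add, map_sub, map_neg, map_mul, map_pow, map_ofNat]

theorem map_numU : f (numU S P) = numU (f S) (f P) := by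
  simp only [numU, map_add, map_sub, map_mul, map_pow, map_ofNat]

theorem map_numV : f (numV S P) = numV (f S) (f P) := by
  simp only [numV, map_add, map_sub, map_mul, map_pow, map_ofNat]

end Map

theorem add_ten_mul_numU_sub : (S + 10) * numU S P - 25 * numV S P = (S ^ 2 - 5 * S - 25) ^ 2 := by
  simp only [numU, numV]
  ring

theorem mul_cubic_numU_numV :
    S * (4 * numV S P ^ 3 - numU S P * numV S P ^ 2 + numU S P * doublePlane S P) =
      40 * numU S P ^ 2 * numV S P - 4 * numU S P ^ 3 - 130 * numU S P * numV S P ^ 2 +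
        135 * numV S P ^ 3 + (25 * numV S P - 10 * numU S P) * doublePlane S P := by
  simp only [numU, numV, doublePlane]
  ring

end CommRing

variable {L : Type*} [Field L] {S P Y u v : L}

theorem mul_cubic_eq (hY : Y ≠ 0) (hF : Y ^ 2 = doublePlane S P) (hu : u * Y = numU S P)
    (hv : v * Y = numV S P) :
    S * (4 * v ^ 3 - u * v ^ 2 + u) =
      40 * u ^ 2 * v - 4 * u ^ 3 - 130 * u * v ^ 2 + 135 * v ^ 3 - 10 * u + 25 * v := by
  refine mul_right_cancel₀ (pow_ne_zero 3 hY) ?_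
  have h := mul_cubic_numU_numV S P
  rw [← hF, ← hu, ← hv] at h
  linear_combination h

theorem mul_add_ten_sub_eq (hu : u * Y = numU S P) (hv : v * Y = numV S P) :
    ((S + 10) * u - 25 * v) * Y = (S ^ 2 - 5 * S - 25) ^ 2 := by
  rw [← add_ten_mul_numU_sub S P, ← hu, ← hv]
  ring

variable [Algebra ℚ L]

theorem sq_sub_mul_sub_ne_zero (hSP : AlgebraicIndependent ℚ ![S, P]) : S ^ 2 - 5 * S - 25 ≠ 0 := by
  have h := aeval_ne_zero_of_eval_ne_zero hSP (c := 0)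
    (p := .X 0 ^ 2 - 5 * .X 0 - 25) (by
      simp only [map_sub, map_mul, map_pow, map_ofNat, MvPolynomial.eval_X, Pi.zero_apply]
      norm_num)
  simpa using h

theorem cubic_ne_zero (hSP : AlgebraicIndependent ℚ ![S, P]) (hF : Y ^ 2 = doublePlane S P)
    (hu : u * Y = numU S P) (hv : v * Y = numV S P) : 4 * v ^ 3 - u * v ^ 2 + u ≠ 0 := by
  intro h0
  let U : MvPolynomial (Fin 2) ℚ := numU (.X 0) (.X 1)
  let V : MvPolynomial (Fin 2) ℚ := numV (.X 0) (.X 1)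
  let F : MvPolynomial (Fin 2) ℚ := doublePlane (.X 0) (.X 1)
  have hne : MvPolynomial.aeval ![S, P] (4 * V ^ 3 - U * V ^ 2 + U * F) ≠ 0 :=
    aeval_ne_zero_of_eval_ne_zero hSP (c := 0) (by
      simp only [U, V, F, numU, numV, doublePlane, map_add, map_sub, map_neg, map_mul, map_pow,
        map_ofNat, MvPolynomial.eval_X, Pi.zero_apply]
      norm_num)
  refine hne ?_
  simp only [U, V, F, map_add, map_sub, map_mul, map_pow, map_ofNat, map_numU, map_numV,
    map_doublePlane, MvPolynomial.aeval_X, Matrix.cons_val_zero, Matrix.cons_val_one, ← hF, ← hu,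
    ← hv]
  linear_combination Y ^ 3 * h0

theorem mem_of_doublePlane (hSP : AlgebraicIndependent ℚ ![S, P]) (hY : Y ≠ 0)
    (hF : Y ^ 2 = doublePlane S P) (hu : u * Y = numU S P) (hv : v * Y = numV S P)
    {E : IntermediateField ℚ L} (huE : u ∈ E) (hvE : v ∈ E) : S ∈ E ∧ P ∈ E ∧ Y ∈ E := by
  have hS : S ∈ E := by
    rw [eq_div_of_mul_eq (cubic_ne_zero hSP hF hu hv) (mul_cubic_eq hY hF hu hv)]
    apply_rules [ofNat_mem, div_mem, add_mem, sub_mem, mul_mem, pow_mem]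
  have hYE : Y ∈ E := by
    have hN : ((S + 10) * u - 25 * v) * Y ≠ 0 := by
      rw [mul_add_ten_sub_eq hu hv]
      exact pow_ne_zero 2 (sq_sub_mul_sub_ne_zero hSP)
    rw [eq_div_of_mul_eq (left_ne_zero_of_mul hN)
      ((mul_comm _ _).trans (mul_add_ten_sub_eq hu hv))]
    apply_rules [ofNat_mem, div_mem, add_mem, sub_mem, mul_mem, pow_mem]
  have hP : P ∈ E := by
    have h25 : (25 : L) ≠ 0 := by
      have := algebraRat.charZero L
      norm_num
    have h : P = (u * Y - (S ^ 3 - 20 * S ^ 2 + 25 * S + 250)) / 25 := by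
      rw [hu, numU, eq_div_iff h25]
      ring
    rw [h]
    apply_rules [ofNat_mem, div_mem, add_mem, sub_mem, mul_mem, pow_mem]
  exact ⟨hS, hP, hYE⟩

theorem algebraicIndependent_of_doublePlane (hSP : AlgebraicIndependent ℚ ![S, P]) (hY : Y ≠ 0)
    (hF : Y ^ 2 = doublePlane S P) (hu : u * Y = numU S P) (hv : v * Y = numV S P) :
    AlgebraicIndependent ℚ ![u, v] := by
  obtain ⟨hS, hP, -⟩ := mem_of_doublePlane hSP hY hF hu hv
    (IntermediateField.subset_adjoin ℚ (Set.range ![u, v]) ⟨0, rfl⟩)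
    (IntermediateField.subset_adjoin ℚ (Set.range ![u, v]) ⟨1, rfl⟩)
  refine algebraicIndependent_of_isAlgebraic_adjoin hSP fun i ↦ ?_
  fin_cases i
  · exact isAlgebraic_algebraMap (⟨S, hS⟩ : IntermediateField.adjoin ℚ (Set.range ![u, v]))
  · exact isAlgebraic_algebraMap (⟨P, hP⟩ : IntermediateField.adjoin ℚ (Set.range ![u, v]))

end DoublePlane

/-! ### The quotient of a Lyness surface by its rotation -/

section Rationality

open AlgebraicGeometry CategoryTheory

/-- The product of the members of a cycle and of the differences of neighbours. -/
def cycBoundary {R : Type*} [CommRing R] (W : Fin 5 → R) : R := (∏ i, W i) * cycY W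

theorem IsLyness.cycY_sq_eq_doublePlane {R : Type*} [CommRing R] {W : Fin 5 → R}
    (h : IsLyness W) : cycY W ^ 2 = doublePlane (cycS W) (cycP W) := by
  rw [h.cycY_eq_sub, doublePlane]
  linear_combination (cycQ W + ∑ i, W i * W (i + 1) ^ 2 +
    (cycS W * cycP W - 2 * cycS W ^ 2 + 4 * cycP W + 15)) * h.cycQ_add_reverse -
    4 * h.cycQ_mul_reverse

theorem IsLyness.cycAlgebra_eq_adjoin {R : Type*} [CommRing R] [Algebra ℚ R] {W : Fin 5 → R}
    (h : IsLyness W) : cycAlgebra W = Algebra.adjoin ℚ {cycS W, cycP W, cycY W} := by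
  have hmem {T : Subalgebra ℚ R} (hS : cycS W ∈ T) (hP : cycP W ∈ T) :
      cycS W * cycP W - 2 * cycS W ^ 2 + 4 * cycP W + 15 ∈ T :=
    add_mem (add_mem (sub_mem (mul_mem hS hP) (mul_mem (ofNat_mem T 2) (pow_mem hS 2)))
      (mul_mem (ofNat_mem T 4) hP)) (ofNat_mem T 15)
  refine le_antisymm (Algebra.adjoin_le ?_) (Algebra.adjoin_le ?_)
  · rintro _ (rfl | rfl | rfl)
    · exact Algebra.subset_adjoin (by simp)
    · exact Algebra.subset_adjoin (by simp)
    · set T := Algebra.adjoin ℚ {cycS W, cycP W, cycY W}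
      have hQ : (2 : ℚ) • cycQ W ∈ T := by
        have hsum : (2 : ℚ) • cycQ W =
            cycY W + (cycS W * cycP W - 2 * cycS W ^ 2 + 4 * cycP W + 15) := by
          rw [ofNat_smul_eq_nsmul, nsmul_eq_mul, Nat.cast_ofNat, h.cycY_eq]
          ring
        rw [hsum]
        exact add_mem (Algebra.subset_adjoin (by simp))
          (hmem (Algebra.subset_adjoin (by simp)) (Algebra.subset_adjoin (by simp)))
      have hhalf := T.smul_mem hQ 2⁻¹
      rwa [inv_smul_smul₀ two_ne_zero] at hhalf
  · rintro _ (rfl | rfl | rfl)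
    · exact cycS_mem_cycAlgebra
    · exact cycP_mem_cycAlgebra
    · rw [h.cycY_eq]
      exact sub_mem (mul_mem (ofNat_mem _ 2) cycQ_mem_cycAlgebra)
        (hmem cycS_mem_cycAlgebra cycP_mem_cycAlgebra)

theorem IsLyness.isAlgebraic {L : Type*} [Field L] [Algebra ℚ L] {W : Fin 5 → L}
    (h : IsLyness W) (i : Fin 5) :
    IsAlgebraic (IntermediateField.adjoin ℚ (Set.range ![cycS W, cycP W])) (W i) := by
  set F := IntermediateField.adjoin ℚ (Set.range ![cycS W, cycP W])
  let S : F := ⟨cycS W, IntermediateField.subset_adjoin _ _ ⟨0, rfl⟩⟩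
  let P : F := ⟨cycP W, IntermediateField.subset_adjoin _ _ ⟨1, rfl⟩⟩
  let E := integralClosure F L
  have hY : cycY W ∈ E := by
    have hsq : cycY W ^ 2 = algebraMap F L (doublePlane S P) := h.cycY_sq_eq_doublePlane
    exact IsIntegral.of_pow two_pos (hsq ▸ isIntegral_algebraMap)
  have hle : cycAlgebra W ≤ E.restrictScalars ℚ := by
    rw [h.cycAlgebra_eq_adjoin]
    refine Algebra.adjoin_le ?_
    rintro _ (rfl | rfl | rfl)
    exacts [E.algebraMap_mem S, E.algebraMap_mem P, hY]
  have hint : IsIntegral E (W i) := (h.isIntegral i).map_of_comp_eq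
    (Subalgebra.inclusion hle).toRingHom (RingHom.id L) rfl
  exact (isIntegral_trans (R := F) (A := E) _ hint).isAlgebraic

theorem IsLyness.algebraicIndependent_cycS_cycP {L : Type*} [Field L] [Algebra ℚ L]
    {W : Fin 5 → L} (h : IsLyness W) (hind : AlgebraicIndependent ℚ ![W 0, W 1]) :
    AlgebraicIndependent ℚ ![cycS W, cycP W] := by
  refine algebraicIndependent_of_isAlgebraic_adjoin hind fun i ↦ ?_
  fin_cases i
  exacts [h.isAlgebraic 0, h.isAlgebraic 1]

section Quotient

theorem numU_mem {A σ : Type*} [CommRing A] [SetLike σ A] [SubringClass σ A] {T : σ} {S P : A}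
    (hS : S ∈ T) (hP : P ∈ T) : numU S P ∈ T :=
  add_mem (add_mem (sub_mem (add_mem (mul_mem (ofNat_mem T 25) hP) (pow_mem hS 3))
    (mul_mem (ofNat_mem T 20) (pow_mem hS 2))) (mul_mem (ofNat_mem T 25) hS)) (ofNat_mem T 250)

theorem numV_mem {A σ : Type*} [CommRing A] [SetLike σ A] [SubringClass σ A] {T : σ} {S P : A}
    (hS : S ∈ T) (hP : P ∈ T) : numV S P ∈ T :=
  add_mem (add_mem (sub_mem (mul_mem (add_mem hS (ofNat_mem T 10)) hP)
    (mul_mem (ofNat_mem T 6) (pow_mem hS 2))) (mul_mem (ofNat_mem T 10) hS)) (ofNat_mem T 75)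

variable {A : Type*} [CommRing A] [Algebra ℚ A] {W : Fin 5 → A} {τ : A →ₐ[ℚ] A}

namespace IsLyness

theorem cycY_mem_cycAlgebra (h : IsLyness W) : cycY W ∈ cycAlgebra W := by
  rw [h.cycAlgebra_eq_adjoin]
  exact Algebra.subset_adjoin (by simp)

theorem cycBoundary_mem_cycAlgebra (h : IsLyness W) : cycBoundary W ∈ cycAlgebra W := by
  rw [cycBoundary, h.prod_eq]
  exact mul_mem (add_mem cycS_mem_cycAlgebra (ofNat_mem _ 3)) h.cycY_mem_cycAlgebra

theorem exists_pow_mul_mem_cycAlgebra (h : IsLyness W)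
    (hgen : ∀ a, ∃ n : ℕ, cycBoundary W ^ n * a ∈ Algebra.adjoin ℚ (Set.range W))
    (hτ : ∀ i, τ (W i) = W (i + 3)) {b : A} (hb : τ b = b) :
    ∃ n : ℕ, cycBoundary W ^ n * b ∈ cycAlgebra W := by
  obtain ⟨n, hn⟩ := hgen b
  refine ⟨n, h.mem_cycAlgebra_of_map_eq hτ hn ?_⟩
  rw [map_mul, map_pow, map_eq_of_mem_cycAlgebra hτ h.cycBoundary_mem_cycAlgebra, hb]

theorem finiteType_equalizer (h : IsLyness W) (hunit : IsUnit (cycBoundary W))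
    (hgen : ∀ a, ∃ n : ℕ, cycBoundary W ^ n * a ∈ Algebra.adjoin ℚ (Set.range W))
    (hτ : ∀ i, τ (W i) = W (i + 3)) :
    Algebra.FiniteType ℚ (AlgHom.equalizer τ (AlgHom.id ℚ A)) := by
  obtain ⟨z, hz⟩ := hunit.exists_left_inv
  have hτz : τ z = z := by
    refine hunit.mul_left_injective ?_
    have hτD := map_eq_of_mem_cycAlgebra hτ h.cycBoundary_mem_cycAlgebra
    have hmap : τ (z * cycBoundary W) = 1 := by rw [hz, map_one]
    exact (hτD ▸ map_mul τ z (cycBoundary W) ▸ hmap).trans hz.symm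
  have heq : AlgHom.equalizer τ (AlgHom.id ℚ A) =
      Algebra.adjoin ℚ {cycS W, cycP W, cycQ W, z} := by
    have hle : cycAlgebra W ≤ Algebra.adjoin ℚ {cycS W, cycP W, cycQ W, z} :=
      Algebra.adjoin_mono (by grind)
    refine le_antisymm (fun b hb ↦ ?_) (Algebra.adjoin_le ?_)
    · obtain ⟨n, hn⟩ := h.exists_pow_mul_mem_cycAlgebra hgen hτ hb
      have hbz : b = z ^ n * (cycBoundary W ^ n * b) := by
        rw [← mul_assoc, ← mul_pow, hz, one_pow, one_mul]
      rw [hbz]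
      exact mul_mem (pow_mem (Algebra.subset_adjoin (by simp)) n) (hle hn)
    · rintro _ (rfl | rfl | rfl | rfl)
      exacts [map_eq_of_mem_cycAlgebra hτ cycS_mem_cycAlgebra,
        map_eq_of_mem_cycAlgebra hτ cycP_mem_cycAlgebra,
        map_eq_of_mem_cycAlgebra hτ cycQ_mem_cycAlgebra, hτz]
  rw [heq, ← Subalgebra.fg_iff_finiteType]
  exact Subalgebra.fg_def.2 ⟨_, Set.toFinite _, rfl⟩

theorem exists_mul_cycY_eq (h : IsLyness W) (hY : IsUnit (cycY W))
    (hτ : ∀ i, τ (W i) = W (i + 3)) {c : A} (hc : c ∈ cycAlgebra W) :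
    ∃ b : AlgHom.equalizer τ (AlgHom.id ℚ A), b * cycY W = c := by
  obtain ⟨b, rfl⟩ := hY.dvd (a := c)
  refine ⟨⟨b, hY.mul_right_injective ?_⟩, mul_comm _ _⟩
  have hb := map_eq_of_mem_cycAlgebra hτ hc
  rwa [map_mul, map_eq_of_mem_cycAlgebra hτ h.cycY_mem_cycAlgebra] at hb

end IsLyness

end Quotient

section Field

variable {L : Type*} [Field L] [Algebra ℚ L] {W : Fin 5 → L} {u v : L}

theorem IsLyness.algebraicIndependent_coordinates (h : IsLyness W)
    (hind : AlgebraicIndependent ℚ ![W 0, W 1]) (hY : cycY W ≠ 0)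
    (hu : u * cycY W = numU (cycS W) (cycP W)) (hv : v * cycY W = numV (cycS W) (cycP W)) :
    AlgebraicIndependent ℚ ![u, v] :=
  algebraicIndependent_of_doublePlane (h.algebraicIndependent_cycS_cycP hind) hY
    h.cycY_sq_eq_doublePlane hu hv

theorem IsLyness.cycAlgebra_le_adjoin_coordinates (h : IsLyness W)
    (hind : AlgebraicIndependent ℚ ![W 0, W 1]) (hY : cycY W ≠ 0)
    (hu : u * cycY W = numU (cycS W) (cycP W)) (hv : v * cycY W = numV (cycS W) (cycP W)) :
    cycAlgebra W ≤ (IntermediateField.adjoin ℚ (Set.range ![u, v])).toSubalgebra := by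
  obtain ⟨hS, hP, hYmem⟩ := mem_of_doublePlane (h.algebraicIndependent_cycS_cycP hind) hY
    h.cycY_sq_eq_doublePlane hu hv
    (IntermediateField.subset_adjoin ℚ (Set.range ![u, v]) ⟨0, rfl⟩)
    (IntermediateField.subset_adjoin ℚ (Set.range ![u, v]) ⟨1, rfl⟩)
  rw [h.cycAlgebra_eq_adjoin]
  refine Algebra.adjoin_le ?_
  rintro _ (rfl | rfl | rfl)
  exacts [hS, hP, hYmem]

end Field

section Map

variable {A L : Type*} [CommRing A] [CommRing L] {W : Fin 5 → A}

section RingHom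

variable {F : Type*} [FunLike F A L] [RingHomClass F A L] (f : F)

theorem IsLyness.map (h : IsLyness W) : IsLyness (f ∘ W) := fun i ↦ by
  simp only [Function.comp_apply, ← map_mul, h i, map_add, map_one]

theorem map_cycS : f (cycS W) = cycS (f ∘ W) := map_sum ..

theorem map_cycP : f (cycP W) = cycP (f ∘ W) := by
  simp only [cycP, map_sum, map_mul, Function.comp_apply]

theorem map_cycQ : f (cycQ W) = cycQ (f ∘ W) := by
  simp only [cycQ, map_sum, map_mul, map_pow, Function.comp_apply]

theorem map_cycY : f (cycY W) = cycY (f ∘ W) := by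
  simp only [cycY, map_prod, map_sub, Function.comp_apply]

end RingHom

theorem map_mem_cycAlgebra [Algebra ℚ A] [Algebra ℚ L] (f : A →ₐ[ℚ] L) {a : A}
    (ha : a ∈ cycAlgebra W) : f a ∈ cycAlgebra (f ∘ W) := by
  rw [cycAlgebra, ← map_cycS, ← map_cycP, ← map_cycQ, ← Set.image_pair, ← Set.image_insert_eq,
    ← AlgHom.map_adjoin]
  exact ⟨a, ha, rfl⟩

end Map

open scoped Pointwise in
theorem IsLyness.isDomain {A : Type*} [CommRing A] [Algebra ℚ A] {W : Fin 5 → A} (h : IsLyness W)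
    (hind : AlgebraicIndependent ℚ ![W 0, W 1]) (hunit : IsUnit (cycBoundary W))
    (hgen : ∀ a, ∃ n : ℕ, cycBoundary W ^ n * a ∈ Algebra.adjoin ℚ (Set.range W)) :
    IsDomain A := by
  set T := Algebra.adjoin ℚ (Set.range ![W 0, W 1])
  have hW (i : Fin 5) : IsUnit (W i) :=
    isUnit_of_dvd_unit (Finset.dvd_prod_of_mem W (Finset.mem_univ i))
      (isUnit_of_mul_isUnit_left hunit)
  have h0 : W 0 ∈ T := Algebra.subset_adjoin ⟨0, rfl⟩
  have h1 : W 1 ∈ T := Algebra.subset_adjoin ⟨1, rfl⟩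
  have hsT : (W 0 * W 1) • Set.range W ⊆ (T : Set A) := by
    rintro _ ⟨_, ⟨i, rfl⟩, rfl⟩
    obtain ⟨r0, -, -, r3, r4⟩ := h.relations 0
    simp only [zero_add] at r0 r3 r4
    have h2 : W 0 * W 1 * W 2 ∈ T := by
      rw [show W 0 * W 1 * W 2 = W 1 * (1 + W 1) by linear_combination W 1 * r0]
      exact mul_mem h1 (add_mem (one_mem T) h1)
    have h3 : W 0 * W 1 * W 3 ∈ T := by
      rw [show W 0 * W 1 * W 3 = W 1 + (1 + W 0) by linear_combination W 1 * r3 + r4]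
      exact add_mem h1 (add_mem (one_mem T) h0)
    have h4 : W 0 * W 1 * W 4 ∈ T := by
      rw [show W 0 * W 1 * W 4 = W 0 * (1 + W 0) by linear_combination W 0 * r4]
      exact mul_mem h0 (add_mem (one_mem T) h0)
    fin_cases i
    exacts [mul_mem (mul_mem h0 h1) h0, mul_mem (mul_mem h0 h1) h1, h2, h3, h4]
  refine isDomain_of_algebraicIndependent hind fun a ↦ ?_
  obtain ⟨n, hn⟩ := hgen a
  obtain ⟨m, hm⟩ := Algebra.pow_smul_mem_of_smul_subset_of_mem_adjoin (W 0 * W 1) _ T hsT hn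
    (mul_mem h0 h1)
  refine ⟨_, (((hW 0).mul (hW 1)).pow m).mul (hunit.pow n), ?_⟩
  rw [mul_assoc]
  exact hm m le_rfl

theorem IsLyness.birationalOver_equalizer {A : Type} [CommRing A] [Algebra ℚ A] {W : Fin 5 → A}
    (h : IsLyness W) (hind : AlgebraicIndependent ℚ ![W 0, W 1])
    (hunit : IsUnit (cycBoundary W))
    (hgen : ∀ a, ∃ n : ℕ, cycBoundary W ^ n * a ∈ Algebra.adjoin ℚ (Set.range W))
    {τ : A →ₐ[ℚ] A} (hτ : ∀ i, τ (W i) = W (i + 3)) :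
    Scheme.BirationalOver
      (Spec.map (CommRingCat.ofHom (algebraMap ℚ (AlgHom.equalizer τ (AlgHom.id ℚ A)))))
      (𝔸(Fin 2; Spec (CommRingCat.of ℚ)) ↘ Spec (CommRingCat.of ℚ)) := by
  have := h.isDomain hind hunit hgen
  have := h.finiteType_equalizer hunit hgen hτ
  have hYunit : IsUnit (cycY W) := isUnit_of_mul_isUnit_right hunit
  obtain ⟨u, hu⟩ := h.exists_mul_cycY_eq hYunit hτ
    (numU_mem cycS_mem_cycAlgebra cycP_mem_cycAlgebra)
  obtain ⟨v, hv⟩ := h.exists_mul_cycY_eq hYunit hτ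
    (numV_mem cycS_mem_cycAlgebra cycP_mem_cycAlgebra)
  let f := IsScalarTower.toAlgHom ℚ A (FractionRing A)
  have hf : Function.Injective f := IsFractionRing.injective A (FractionRing A)
  have hindf : AlgebraicIndependent ℚ ![(f ∘ W) 0, (f ∘ W) 1] := by
    convert (f.algebraicIndependent_iff hf).2 hind using 1
    ext i
    fin_cases i <;> rfl
  have hY : cycY (f ∘ W) ≠ 0 := map_cycY f ▸ (hYunit.map f).ne_zero
  have huf : f u * cycY (f ∘ W) = numU (cycS (f ∘ W)) (cycP (f ∘ W)) := by
    rw [← map_cycY, ← map_mul, hu, map_numU, map_cycS, map_cycP]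
  have hvf : f v * cycY (f ∘ W) = numV (cycS (f ∘ W)) (cycP (f ∘ W)) := by
    rw [← map_cycY, ← map_mul, hv, map_numV, map_cycS, map_cycP]
  have hfuv : algebraMap _ (FractionRing A) ∘ ![u, v] = ![f u, f v] := by
    ext i
    fin_cases i <;> rfl
  refine birationalOver_affineSpace (L := FractionRing A) (x := ![u, v]) ?_ fun b ↦ ?_
  · rw [hfuv]
    exact (h.map f).algebraicIndependent_coordinates hindf hY huf hvf
  · obtain ⟨n, hn⟩ := h.exists_pow_mul_mem_cycAlgebra hgen hτ b.2
    rw [hfuv]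
    have hle := (h.map f).cycAlgebra_le_adjoin_coordinates hindf hY huf hvf
    have hd := hle (map_mem_cycAlgebra f h.cycBoundary_mem_cycAlgebra)
    have hdb := hle (map_mem_cycAlgebra f hn)
    have hd0 : f (cycBoundary W) ^ n ≠ 0 := pow_ne_zero n (hunit.map f).ne_zero
    rw [map_mul, map_pow] at hdb
    exact (mul_div_cancel_left₀ (f b) hd0) ▸ div_mem hdb (pow_mem hd n)

end Rationality

/-! ### Cross-ratios -/

section Bracket

variable {R F : Type*} [CommRing R] [Field F]

/-- The bracket (determinant) of two vectors of the plane. -/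
def br (v w : Fin 2 → R) : R := v 0 * w 1 - v 1 * w 0

theorem br_vec2 (a b c d : R) : br ![a, b] ![c, d] = a * d - b * c :=
  rfl

theorem br_self (v : Fin 2 → R) : br v v = 0 := by
  rw [br, mul_comm, sub_self]

theorem br_swap (v w : Fin 2 → R) : br v w = -br w v := by
  simp only [br]
  ring

theorem br_smul_left (c : R) (v w : Fin 2 → R) : br (c • v) w = c * br v w := by
  simp only [br, Pi.smul_apply, smul_eq_mul]
  ring

theorem br_smul_right (c : R) (v w : Fin 2 → R) : br v (c • w) = c * br v w := by
  simp only [br, Pi.smul_apply, smul_eq_mul]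
  ring

theorem br_mulVec (M : Matrix (Fin 2) (Fin 2) R) (v w : Fin 2 → R) :
    br (M.mulVec v) (M.mulVec w) = M.det * br v w := by
  simp only [br, Matrix.mulVec_eq_sum, Fin.sum_univ_two, Matrix.det_fin_two, Pi.add_apply,
    Pi.smul_apply, Matrix.transpose_apply, MulOpposite.smul_eq_mul_unop, MulOpposite.unop_op]
  ring

theorem exists_smul_eq_iff_br_eq_zero {v w : Fin 2 → F} (hw : w ≠ 0) :
    (∃ c : F, c • w = v) ↔ br v w = 0 := by
  constructor
  · rintro ⟨c, rfl⟩
    rw [br_smul_left, br_self, mul_zero]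
  · intro h
    obtain ⟨i, hi⟩ := Function.ne_iff.1 hw
    refine ⟨v i / w i, ?_⟩
    simp only [br, Pi.zero_apply] at h hi
    ext j
    fin_cases i <;> fin_cases j <;> simp only [Pi.smul_apply, smul_eq_mul] <;> grind

theorem mk_eq_mk_iff_br_eq_zero {v w : Fin 2 → F} (hv : v ≠ 0) (hw : w ≠ 0) :
    Projectivization.mk F v hv = Projectivization.mk F w hw ↔ br v w = 0 :=
  (Projectivization.mk_eq_mk_iff' F v w hv hw).trans (exists_smul_eq_iff_br_eq_zero hw)

theorem MTilde.br_ne_zero (x : MTilde) {i j : Fin 5} (h : i ≠ j) :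
    br (x.p i).rep (x.p j).rep ≠ 0 := by
  rw [Ne, ← mk_eq_mk_iff_br_eq_zero (x.p i).rep_nonzero (x.p j).rep_nonzero,
    Projectivization.mk_rep, Projectivization.mk_rep]
  exact x.inj.ne h

end Bracket

section CrossRatio

variable {F : Type*} [Field F] {V : Fin 5 → Fin 2 → F}

/-- The cross-ratio of the points `V (2i), …, V (2i + 3)` of a cyclic sequence of five points of the
projective line. Two cross-ratios with consecutive indices come from sequences that are two steps
apart; numbered in this way, the five cross-ratios satisfy the Lyness recurrence. -/
def crossRatio (V : Fin 5 → Fin 2 → F) (i : Fin 5) : F :=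
  br (V (2 * i + 1)) (V (2 * i + 2)) * br (V (2 * i)) (V (2 * i + 3)) /
    (br (V (2 * i)) (V (2 * i + 1)) * br (V (2 * i + 2)) (V (2 * i + 3)))

theorem crossRatio_ne_zero (hV : Pairwise fun i j ↦ br (V i) (V j) ≠ 0) (i : Fin 5) :
    crossRatio V i ≠ 0 := by
  refine div_ne_zero (mul_ne_zero ?_ ?_) (mul_ne_zero ?_ ?_) <;> refine hV ?_ <;> simp

theorem one_add_crossRatio (hV : Pairwise fun i j ↦ br (V i) (V j) ≠ 0) (i : Fin 5) :
    1 + crossRatio V i = br (V (2 * i)) (V (2 * i + 2)) * br (V (2 * i + 1)) (V (2 * i + 3)) /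
      (br (V (2 * i)) (V (2 * i + 1)) * br (V (2 * i + 2)) (V (2 * i + 3))) := by
  have h1 : br (V (2 * i)) (V (2 * i + 1)) ≠ 0 := hV (by simp)
  have h2 : br (V (2 * i + 2)) (V (2 * i + 3)) ≠ 0 := hV (by simp)
  rw [crossRatio]
  field_simp
  simp only [br]
  ring

theorem isLyness_crossRatio (hV : Pairwise fun i j ↦ br (V i) (V j) ≠ 0) :
    IsLyness (crossRatio V) := by
  intro i
  rw [one_add_crossRatio hV]
  simp only [crossRatio, mul_add, add_assoc, Fin.reduceAdd, Fin.reduceMul, add_zero, mul_one]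
  have h1 : br (V (2 * i)) (V (2 * i + 1)) ≠ 0 := hV (by simp)
  have h2 : br (V (2 * i + 2)) (V (2 * i + 3)) ≠ 0 := hV (by simp)
  have h3 : br (V (2 * i + 4)) (V (2 * i)) ≠ 0 := hV (by simp)
  have h4 : br (V (2 * i + 1)) (V (2 * i + 2)) ≠ 0 := hV (by simp)
  rw [br_swap (V (2 * i + 4)) (V (2 * i + 2)), br_swap (V (2 * i + 3)) (V (2 * i))]
  field_simp

theorem crossRatio_congr {V' : Fin 5 → Fin 2 → F} {d : F} (hd : d ≠ 0) {c : Fin 5 → F}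
    (hc : ∀ i, c i ≠ 0) (h : ∀ i j, br (V' i) (V' j) = c i * c j * d * br (V i) (V j)) :
    crossRatio V' = crossRatio V := by
  ext i
  simp only [crossRatio, h]
  rw [mul_mul_mul_comm, mul_mul_mul_comm _ (br (V (2 * i)) _)]
  convert mul_div_mul_left _ _ (c := c (2 * i) * c (2 * i + 1) * c (2 * i + 2) * c (2 * i + 3) *
    d ^ 2) _ using 2
  · ring
  · ring
  · simp [hc, hd]

/-- The five cross-ratios of the cycle of a point of `M̃₂(5)`, which are coordinates on
`M₂(5)`. -/
def lyn (x : MTilde) : Fin 5 → K := crossRatio fun i ↦ (x.p i).rep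

theorem isLyness_lyn (x : MTilde) : IsLyness (lyn x) :=
  isLyness_crossRatio fun _ _ ↦ x.br_ne_zero

theorem lyn_ne_zero (x : MTilde) (i : Fin 5) : lyn x i ≠ 0 :=
  crossRatio_ne_zero (fun _ _ ↦ x.br_ne_zero) i

theorem lyn_shift (x : MTilde) (i : Fin 5) : lyn (shift x) i = lyn x (i + 3) := by
  simp only [lyn, crossRatio, shift, mul_add, add_assoc, Fin.reduceAdd, Fin.reduceMul]

theorem exists_rep_smul (g : GL (Fin 2) K) (q : P1) :
    ∃ c : K, c ≠ 0 ∧ (Matrix.ProjGenLinGroup.mk g • q).rep = c • g.1.mulVec q.rep := by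
  obtain ⟨c, hc⟩ := Projectivization.exists_smul_eq_mk_rep K (g • q.rep)
    ((smul_ne_zero_iff_ne g).2 q.rep_nonzero)
  refine ⟨c, c.ne_zero, ?_⟩
  conv_lhs => rw [← q.mk_rep]
  exact hc.symm

theorem lyn_eq_of_sameOrbit {x y : MTilde} (h : SameOrbit x y) : lyn x = lyn y := by
  obtain ⟨g, -, hp⟩ := h
  obtain ⟨g, rfl⟩ := Matrix.ProjGenLinGroup.mk_surjective g
  choose c hc0 hc using fun i ↦ exists_rep_smul g (x.p i)
  refine (crossRatio_congr (Matrix.GeneralLinearGroup.det_ne_zero g) hc0 fun i j ↦ ?_).symm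
  rw [hp, hp, hc, hc, br_smul_left, br_smul_right, br_mulVec, ← mul_assoc, ← mul_assoc]

end CrossRatio

section Quad

theorem quad_smul (c : K) (a : Fin 6 → K) (v : Fin 2 → K) : quad (c • a) v = c • quad a v := by
  simp only [quad, Pi.smul_apply, smul_eq_mul, Matrix.smul_vec2]
  ring_nf

theorem quad_vec_smul (a : Fin 6 → K) (c : K) (v : Fin 2 → K) :
    quad a (c • v) = c ^ 2 • quad a v := by
  simp only [quad, Pi.smul_apply, smul_eq_mul, Matrix.smul_vec2]
  ring_nf

theorem exists_quad_eq_mulVec_quad (N : Matrix (Fin 2) (Fin 2) K) (a : Fin 6 → K) :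
    ∃ b, ∀ v, quad b v = N.mulVec (quad a v) := by
  refine ⟨![N 0 0 * a 0 + N 0 1 * a 3, N 0 0 * a 1 + N 0 1 * a 4, N 0 0 * a 2 + N 0 1 * a 5,
    N 1 0 * a 0 + N 1 1 * a 3, N 1 0 * a 1 + N 1 1 * a 4, N 1 0 * a 2 + N 1 1 * a 5], fun v ↦ ?_⟩
  refine funext (Fin.forall_fin_two.2 ⟨?_, ?_⟩) <;>
    simp only [quad, Matrix.mulVec, Matrix.vec2_dotProduct, Matrix.cons_val] <;> ring

theorem exists_quad_eq_quad_mulVec (M : Matrix (Fin 2) (Fin 2) K) (a : Fin 6 → K) :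
    ∃ b, ∀ v, quad b v = quad a (M.mulVec v) := by
  refine ⟨![a 0 * M 0 0 ^ 2 + a 1 * M 0 0 * M 1 0 + a 2 * M 1 0 ^ 2,
    2 * a 0 * M 0 0 * M 0 1 + a 1 * (M 0 0 * M 1 1 + M 0 1 * M 1 0) + 2 * a 2 * M 1 0 * M 1 1,
    a 0 * M 0 1 ^ 2 + a 1 * M 0 1 * M 1 1 + a 2 * M 1 1 ^ 2,
    a 3 * M 0 0 ^ 2 + a 4 * M 0 0 * M 1 0 + a 5 * M 1 0 ^ 2,
    2 * a 3 * M 0 0 * M 0 1 + a 4 * (M 0 0 * M 1 1 + M 0 1 * M 1 0) + 2 * a 5 * M 1 0 * M 1 1,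
    a 3 * M 0 1 ^ 2 + a 4 * M 0 1 * M 1 1 + a 5 * M 1 1 ^ 2], fun v ↦ ?_⟩
  simp only [quad, Matrix.cons_val, Matrix.mulVec, Matrix.vec2_dotProduct]
  ring_nf

theorem exists_quad_mulVec_eq {N : Matrix (Fin 2) (Fin 2) K} (hN : N.det ≠ 0) (a : Fin 6 → K) :
    ∃ b, ∀ v, quad b (N.mulVec v) = N.mulVec (quad a v) := by
  obtain ⟨b, hb⟩ := exists_quad_eq_mulVec_quad N a
  obtain ⟨c, hc⟩ := exists_quad_eq_quad_mulVec N⁻¹ b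
  refine ⟨c, fun v ↦ ?_⟩
  rw [hc, hb, Matrix.mulVec_mulVec, Matrix.nonsing_inv_mul _ hN.isUnit, Matrix.one_mulVec]

variable {N : Matrix (Fin 2) (Fin 2) K} {a b : Fin 6 → K}

theorem forall_quad_ne_zero_of_quad_mulVec_eq (hN : N.det ≠ 0)
    (hb : ∀ v, quad b (N.mulVec v) = N.mulVec (quad a v)) (ha : ∀ v, v ≠ 0 → quad a v ≠ 0) :
    ∀ v, v ≠ 0 → quad b v ≠ 0 := by
  intro v hv
  rw [← Matrix.one_mulVec v, ← Matrix.mul_nonsing_inv _ hN.isUnit, ← Matrix.mulVec_mulVec] at hv ⊢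
  rw [hb]
  exact fun h ↦ ha _ (fun h0 ↦ hv (h0 ▸ N.mulVec_zero)) (Matrix.eq_zero_of_mulVec_eq_zero hN h)

end Quad

/-! ### Normalized cycles -/

section Slice

variable {R F : Type*} [CommRing R] [Field F]

/-- Homogeneous coordinates of a cycle of five points of the projective line whose cross-ratios are
`W`, normalized by `p₁ = 1`, `p₃ = ∞` and `p₄ = 0`. -/
def slicePoints (W : Fin 5 → R) : Fin 5 → Fin 2 → R :=
  ![![1, 1], ![1 + W 0, W 0], ![1, 0], ![0, 1], ![W 1, 1 + W 1]]

/-- Coefficients of the endomorphism of degree `2` with cycle `slicePoints W`, obtained by solving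
the linear equations `f(pᵢ) = pᵢ₊₁`. -/
def sliceQuad (W : Fin 5 → R) : Fin 6 → R :=
  ![0,
    (1 + W 0) * ((1 + W 4) * (W 0 - W 1) + (1 + W 0 - W 1 ^ 2) * (W 3 - W 4)),
    W 1 ^ 2 * (1 + W 0) * (W 3 - W 4),
    -(1 + W 1) * (1 + W 4) * (W 0 - W 1),
    W 0 * ((1 + W 0) * (1 - W 1 * W 2) * (W 3 - W 4) + (1 + W 2) * (1 + W 4) * (W 0 - W 1)),
    W 1 * (1 + W 1) * (1 + W 0) * (W 3 - W 4)]

/-- The resultant of the two quadratic forms with coefficients `a`, divided by `a 3`, when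
`a 0 = 0`. -/
def reducedResultant (a : Fin 6 → R) : R := a 3 * a 2 ^ 2 - a 4 * a 1 * a 2 + a 5 * a 1 ^ 2

theorem quad_ne_zero {a : Fin 6 → K} (h0 : a 0 = 0) (h3 : a 3 ≠ 0) (hr : reducedResultant a ≠ 0)
    {v : Fin 2 → K} (hv : v ≠ 0) : quad a v ≠ 0 := by
  intro h
  have e0 := congrFun h 0
  have e1 := congrFun h 1
  simp only [quad, reducedResultant, h0, Matrix.cons_val_zero, Matrix.cons_val_one,
    Pi.zero_apply] at e0 e1 hr
  have hv1 : v 1 ≠ 0 := by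
    intro hv1
    have hv0 : v 0 = 0 := by simpa [hv1, h3] using e1
    exact hv (by ext i; fin_cases i <;> assumption)
  have hv0 : a 1 * v 0 + a 2 * v 1 = 0 := by grind
  refine mul_ne_zero hr (pow_ne_zero 2 hv1) ?_
  linear_combination a 1 ^ 2 * e1 - (a 3 * (a 1 * v 0 - a 2 * v 1) + a 4 * a 1 * v 1) * hv0

theorem coeff_three_ne_zero {a : Fin 6 → K} (h0 : a 0 = 0) (ha : ∀ v, v ≠ 0 → quad a v ≠ 0) :
    a 3 ≠ 0 := by
  intro h3
  refine ha ![1, 0] (by simp) ?_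
  ext i
  fin_cases i <;> simp [quad, h0, h3]

theorem reducedResultant_ne_zero {a : Fin 6 → K} (h0 : a 0 = 0) (h2 : a 2 ≠ 0)
    (ha : ∀ v, v ≠ 0 → quad a v ≠ 0) : reducedResultant a ≠ 0 := by
  intro hr
  rw [reducedResultant] at hr
  refine ha ![a 2, -a 1] (fun h ↦ h2 (congrFun h 0)) ?_
  ext i
  fin_cases i
  · simp only [quad, h0, Fin.zero_eta, Matrix.cons_val, Pi.zero_apply]
    ring
  · simp only [quad, Fin.mk_one, Matrix.cons_val, Pi.zero_apply]
    linear_combination hr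

theorem IsLyness.one_add_ne_zero {W : Fin 5 → F} (h : IsLyness W) (h0 : ∀ i, W i ≠ 0)
    (i : Fin 5) : 1 + W i ≠ 0 := by
  obtain ⟨-, -, -, -, r⟩ := h.relations i
  exact r ▸ mul_ne_zero (h0 _) (h0 _)

theorem IsLyness.eq_div {W : Fin 5 → F} (h : IsLyness W) (h0 : W 0 ≠ 0) (h1 : W 1 ≠ 0) :
    W 2 = (1 + W 1) / W 0 ∧ W 3 = (1 + W 0 + W 1) / (W 0 * W 1) ∧ W 4 = (1 + W 0) / W 1 := by
  obtain ⟨r0, r1, r2, r3, r4⟩ := h.relations 0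
  simp only [zero_add] at r0 r1 r2 r3 r4
  refine ⟨?_, ?_, ?_⟩ <;> field_simp <;> grind

theorem IsLyness.ext {W W' : Fin 5 → F} (h : IsLyness W) (h' : IsLyness W') (h0 : W 0 ≠ 0)
    (h1 : W 1 ≠ 0) (e0 : W' 0 = W 0) (e1 : W' 1 = W 1) : W' = W := by
  obtain ⟨e2, e3, e4⟩ := h.eq_div h0 h1
  obtain ⟨e2', e3', e4'⟩ := h'.eq_div (e0 ▸ h0) (e1 ▸ h1)
  rw [e0, e1] at e2' e3' e4'
  ext i
  fin_cases i
  exacts [e0, e1, e2'.trans e2.symm, e3'.trans e3.symm, e4'.trans e4.symm]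

theorem reducedResultant_sliceQuad {W : Fin 5 → F} (h : IsLyness W) (h0 : W 0 ≠ 0) (h1 : W 1 ≠ 0) :
    sliceQuad W 3 * reducedResultant (sliceQuad W) =
      -(W 0 ^ 4 * W 1 ^ 4 * W 2 ^ 2 * W 3 ^ 2 * W 4 ^ 2 * cycY W) := by
  obtain ⟨e2, e3, e4⟩ := h.eq_div h0 h1
  simp only [reducedResultant, sliceQuad, cycY, Fin.prod_univ_five, Fin.reduceAdd, zero_add,
    Matrix.cons_val, e2, e3, e4]
  field_simp
  ring

theorem forall_br_quad_slicePoints_iff {W : Fin 5 → K} {a : Fin 6 → K} :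
    (∀ i, br (quad a (slicePoints W i)) (slicePoints W (i + 1)) = 0) ↔
      a 0 = 0 ∧ a 2 * (1 + W 1) = a 5 * W 1 ∧
      (a 1 + a 2) * W 0 = (a 3 + a 4 + a 5) * (1 + W 0) ∧
      a 3 * (1 + W 0) ^ 2 + a 4 * W 0 * (1 + W 0) + a 5 * W 0 ^ 2 = 0 ∧
      a 1 * W 1 * (1 + W 1) + a 2 * (1 + W 1) ^ 2 =
        a 3 * W 1 ^ 2 + a 4 * W 1 * (1 + W 1) + a 5 * (1 + W 1) ^ 2 := by
  rw [Fin.forall_fin_succ, Fin.forall_fin_succ, Fin.forall_fin_succ, Fin.forall_fin_two]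
  simp only [br, quad, slicePoints, Fin.reduceAdd, Fin.reduceSucc, zero_add, Matrix.cons_val,
    Fin.succ_zero_eq_one, Fin.succ_one_eq_two]
  constructor
  · rintro ⟨h0, h1, h2, h3, h4⟩
    refine ⟨?_, ?_, ?_, ?_, ?_⟩
    · linear_combination h2
    · linear_combination h3
    · linear_combination h0 - W 0 * h2
    · linear_combination -h1
    · linear_combination h4 - W 1 ^ 2 * h2
  · rintro ⟨h0, h1, h2, h3, h4⟩
    refine ⟨?_, ?_, ?_, ?_, ?_⟩
    · linear_combination h2 + W 0 * h0
    · linear_combination -h3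
    · linear_combination h0
    · linear_combination h1
    · linear_combination h4 + W 1 ^ 2 * h0

theorem br_quad_sliceQuad {W : Fin 5 → K} (h : IsLyness W) (i : Fin 5) :
    br (quad (sliceQuad W) (slicePoints W i)) (slicePoints W (i + 1)) = 0 := by
  obtain ⟨r0, r1, r2, r3, r4⟩ := h.relations 0
  simp only [zero_add] at r0 r1 r2 r3 r4
  refine forall_br_quad_slicePoints_iff.2 ⟨?_, ?_, ?_, ?_, ?_⟩ i <;>
    simp only [sliceQuad, Matrix.cons_val] <;> grind

theorem pairwise_br_slicePoints_ne_zero {W : Fin 5 → F} (h : IsLyness W) (h0 : ∀ i, W i ≠ 0) :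
    Pairwise fun i j ↦ br (slicePoints W i) (slicePoints W j) ≠ 0 := by
  have hW : 1 + W 0 ≠ 0 ∧ 1 + W 1 ≠ 0 ∧ 1 + W 0 + W 1 ≠ 0 := by
    obtain ⟨r0, -, -, r3, r4⟩ := h.relations 0
    simp only [zero_add] at r0 r3 r4
    have h034 := mul_ne_zero (mul_ne_zero (h0 3) (h0 0)) (h0 1)
    refine ⟨r4 ▸ mul_ne_zero (h0 4) (h0 1), r0 ▸ mul_ne_zero (h0 0) (h0 2), ?_⟩
    convert h034 using 1
    linear_combination -r4 - W 1 * r3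
  have hW0 := h0 0
  have hW1 := h0 1
  intro i j hij
  fin_cases i <;> fin_cases j <;>
    simp only [br, slicePoints, Fin.zero_eta, Fin.mk_one, Fin.reduceFinMk, Matrix.cons_val] <;>
    grind

section Uniqueness

variable {W : Fin 5 → K} {a : Fin 6 → K} {l : K}

theorem coeff_three_mul_eq (h : IsLyness W) (h0 : W 0 ≠ 0) (h1 : W 1 ≠ 0)
    (hc : ∀ i, br (quad a (slicePoints W i)) (slicePoints W (i + 1)) = 0)
    (h2 : a 2 = l * W 1) (h5 : a 5 = l * (1 + W 1)) :
    a 3 * (W 1 * (1 + W 0) * (W 3 - W 4)) = -l * (1 + W 1) * (1 + W 4) * (W 0 - W 1) := by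
  obtain ⟨-, -, e0, e1, e4⟩ := forall_br_quad_slicePoints_iff.1 hc
  obtain ⟨-, -, -, r3, r4⟩ := h.relations 0
  simp only [zero_add] at r3 r4
  rw [h2, h5] at e0 e4
  rw [h5] at e1
  have e : a 3 * W 1 * (1 + W 0) * (1 + W 1 - W 0 ^ 2) +
      l * W 0 * (1 + W 1) * (1 + W 0 + W 1) * (W 0 - W 1) = 0 := by
    linear_combination W 0 * (1 + W 0) * W 1 * (1 + W 1) * e0 + W 1 * (1 + W 1) * e1 -
      W 0 ^ 2 * (1 + W 0) * e4
  refine mul_left_cancel₀ (mul_ne_zero h0 h1) ?_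
  linear_combination e + a 3 * W 1 * (1 + W 0) * (W 1 * r3 + (1 - W 0) * r4) +
    l * W 0 * (1 + W 1) * (W 0 - W 1) * r4

theorem forall_quad_sliceQuad_ne_zero_iff (h : IsLyness W) (h0 : ∀ i, W i ≠ 0) :
    (∀ v, v ≠ 0 → quad (sliceQuad W) v ≠ 0) ↔ cycY W ≠ 0 := by
  have hr : sliceQuad W 3 * reducedResultant (sliceQuad W) ≠ 0 ↔ cycY W ≠ 0 := by
    rw [reducedResultant_sliceQuad h (h0 0) (h0 1)]
    simp [h0]
  rw [← hr, mul_ne_zero_iff]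
  refine ⟨fun ha ↦ ⟨coeff_three_ne_zero rfl ha, reducedResultant_ne_zero rfl (fun h2 ↦ ?_) ha⟩,
    fun ha v ↦ quad_ne_zero rfl ha.1 ha.2⟩
  have h34 : W 3 - W 4 = 0 := by
    simpa [sliceQuad, h0, h.one_add_ne_zero h0] using h2
  refine ha ![0, 1] (by simp) ?_
  ext i
  fin_cases i <;> simp [quad, sliceQuad, h34]

theorem exists_coeff_eq_mul (h1 : W 1 ≠ 0) (ha : ∀ v, v ≠ 0 → quad a v ≠ 0)
    (hc : ∀ i, br (quad a (slicePoints W i)) (slicePoints W (i + 1)) = 0) :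
    ∃ l ≠ 0, a 2 = l * W 1 ∧ a 5 = l * (1 + W 1) := by
  obtain ⟨-, h25, -⟩ := forall_br_quad_slicePoints_iff.1 hc
  have h2 : a 2 = a 2 / W 1 * W 1 := by field_simp
  have h5 : a 5 = a 2 / W 1 * (1 + W 1) := by
    field_simp
    exact h25.symm
  refine ⟨a 2 / W 1, fun hl ↦ ha ![0, 1] (by simp) ?_, h2, h5⟩
  rw [hl, zero_mul] at h2 h5
  ext i
  fin_cases i <;> simp [quad, h2, h5]

theorem IsLyness.apply_three_ne_apply_four (h : IsLyness W) (h0 : ∀ i, W i ≠ 0)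
    (ha : ∀ v, v ≠ 0 → quad a v ≠ 0)
    (hc : ∀ i, br (quad a (slicePoints W i)) (slicePoints W (i + 1)) = 0) : W 3 ≠ W 4 := by
  intro h34
  -- Then all `W i` are equal, `W i ^ 2 = 1 + W i`, and the resultant of `a` vanishes.
  obtain ⟨l, hl, h2, h5⟩ := exists_coeff_eq_mul (h0 1) ha hc
  have h01 : W 0 = W 1 := by
    have := coeff_three_mul_eq h (h0 0) (h0 1) hc h2 h5
    rw [h34, sub_self, mul_zero, mul_zero, eq_comm] at this
    simpa [hl, h.one_add_ne_zero h0, sub_eq_zero] using this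
  obtain ⟨-, -, -, r3, r4⟩ := h.relations 0
  simp only [zero_add, h34, ← h01] at r3 r4 h2 h5
  have hsq : W 0 ^ 2 = 1 + W 0 := by grind
  obtain ⟨ha0, -, e0, e1, -⟩ := forall_br_quad_slicePoints_iff.1 hc
  rw [← hsq] at e0 e1 h5
  have h4 : a 4 = -W 0 * (a 3 + l) := mul_left_cancel₀ (pow_ne_zero 3 (h0 0)) (by grind)
  have ha1 : a 1 = -a 3 := mul_left_cancel₀ (h0 0) (by grind)
  refine reducedResultant_ne_zero ha0 (h2 ▸ mul_ne_zero hl (h0 0)) ha ?_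
  rw [reducedResultant, ha1, h2, h4, h5]
  ring

theorem eq_of_forall_br_quad_slicePoints {b : Fin 6 → K} (h0 : W 0 ≠ 0)
    (h0' : 1 + W 0 ≠ 0) (h1' : 1 + W 1 ≠ 0)
    (ha : ∀ i, br (quad a (slicePoints W i)) (slicePoints W (i + 1)) = 0)
    (hb : ∀ i, br (quad b (slicePoints W i)) (slicePoints W (i + 1)) = 0)
    (h3 : a 3 = b 3) (h5 : a 5 = b 5) : a = b := by
  obtain ⟨a0, a2, ea0, ea1, -⟩ := forall_br_quad_slicePoints_iff.1 ha
  obtain ⟨b0, b2, eb0, eb1, -⟩ := forall_br_quad_slicePoints_iff.1 hb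
  have h4 : a 4 = b 4 := mul_left_cancel₀ (mul_ne_zero h0 h0') (by grind)
  have h2 : a 2 = b 2 := mul_right_cancel₀ h1' (by rw [a2, b2, h5])
  have h1 : a 1 = b 1 := mul_left_cancel₀ h0 (by grind)
  ext j
  fin_cases j
  exacts [a0.trans b0.symm, h1, h2, h3, h4, h5]

theorem exists_eq_smul_sliceQuad (h : IsLyness W) (h0 : ∀ i, W i ≠ 0)
    (ha : ∀ v, v ≠ 0 → quad a v ≠ 0)
    (hc : ∀ i, br (quad a (slicePoints W i)) (slicePoints W (i + 1)) = 0) :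
    ∃ l : K, l ≠ 0 ∧ a = l • sliceQuad W := by
  obtain ⟨l, hl, h2, h5⟩ := exists_coeff_eq_mul (h0 1) ha hc
  have hW := h.one_add_ne_zero h0
  have hd : W 1 * (1 + W 0) * (W 3 - W 4) ≠ 0 := mul_ne_zero (mul_ne_zero (h0 1) (hW 0))
    (sub_ne_zero.2 (h.apply_three_ne_apply_four h0 ha hc))
  have h3 := coeff_three_mul_eq h (h0 0) (h0 1) hc h2 h5
  refine ⟨l / (W 1 * (1 + W 0) * (W 3 - W 4)), div_ne_zero hl hd,
    eq_of_forall_br_quad_slicePoints (h0 0) (hW 0) (hW 1) hc (fun i ↦ ?_) ?_ ?_⟩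
  · rw [quad_smul, br_smul_left, br_quad_sliceQuad h, mul_zero]
  · rw [Pi.smul_apply, smul_eq_mul, div_mul_eq_mul_div, eq_div_iff hd, h3, sliceQuad]
    simp only [Matrix.cons_val]
    ring
  · rw [Pi.smul_apply, smul_eq_mul, div_mul_eq_mul_div, eq_div_iff hd, h5, sliceQuad]
    simp only [Matrix.cons_val]
    ring

end Uniqueness

end Slice

section OfCycle

variable {a : Fin 6 → K} {V : Fin 5 → Fin 2 → K}

theorem End2.eval_mk_eq_mk_iff (f : End2) {v w : Fin 2 → K} (hv : v ≠ 0) (hw : w ≠ 0) :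
    f.eval (.mk K v hv) = .mk K w hw ↔ br (quad f.1.rep v) w = 0 := by
  obtain ⟨c, hc⟩ := Projectivization.exists_smul_eq_mk_rep K v hv
  rw [End2.eval, mk_eq_mk_iff_br_eq_zero, ← hc, Units.smul_def, quad_vec_smul, br_smul_left,
    mul_eq_zero_iff_left (pow_ne_zero 2 c.ne_zero)]

/-- The endomorphism of degree `2` with coefficients `a`. -/
def End2.ofQuad (a : Fin 6 → K) (ha : ∀ v, v ≠ 0 → quad a v ≠ 0) : End2 where
  val := .mk K a fun h ↦ ha ![1, 0] (by simp) (by simp [h, quad])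
  property v hv h := by
    obtain ⟨c, hc⟩ := Projectivization.exists_smul_eq_mk_rep K a _
    rw [← hc, Units.smul_def, quad_smul] at h
    exact smul_ne_zero c.ne_zero (ha v hv) h

theorem End2.exists_rep_ofQuad (ha : ∀ v, v ≠ 0 → quad a v ≠ 0) :
    ∃ c : K, c ≠ 0 ∧ (End2.ofQuad a ha).1.rep = c • a := by
  obtain ⟨c, hc⟩ := Projectivization.exists_smul_eq_mk_rep K a _
  exact ⟨c, c.ne_zero, hc.symm⟩

/-- The point of `M̃₂(5)` whose endomorphism has coefficients `a` and whose cycle has homogeneous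
coordinates `V`. -/
def MTilde.ofCycle (a : Fin 6 → K) (V : Fin 5 → Fin 2 → K) (ha : ∀ v, v ≠ 0 → quad a v ≠ 0)
    (hV : Pairwise fun i j ↦ br (V i) (V j) ≠ 0)
    (hc : ∀ i, br (quad a (V i)) (V (i + 1)) = 0) : MTilde where
  f := .ofQuad a ha
  p i := .mk K (V i) fun h ↦ hV (i := i) (j := i + 1) (by simp) (by simp [h, br])
  inj i j h := by
    by_contra hij
    exact hV hij ((mk_eq_mk_iff_br_eq_zero _ _).1 h)
  cycle i := by
    obtain ⟨c, -, hc'⟩ := End2.exists_rep_ofQuad ha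
    rw [End2.eval_mk_eq_mk_iff, hc', quad_smul, br_smul_left, hc, mul_zero]

theorem MTilde.exists_rep_ofCycle (ha : ∀ v, v ≠ 0 → quad a v ≠ 0)
    (hV : Pairwise fun i j ↦ br (V i) (V j) ≠ 0) (hc : ∀ i, br (quad a (V i)) (V (i + 1)) = 0)
    (i : Fin 5) : ∃ c : K, c ≠ 0 ∧ ((MTilde.ofCycle a V ha hV hc).p i).rep = c • V i := by
  obtain ⟨c, hc⟩ := Projectivization.exists_smul_eq_mk_rep K (V i) _
  exact ⟨c, c.ne_zero, hc.symm⟩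

theorem MTilde.br_quad (x : MTilde) (i : Fin 5) :
    br (quad x.f.1.rep (x.p i).rep) (x.p (i + 1)).rep = 0 := by
  rw [← x.f.eval_mk_eq_mk_iff (x.p i).rep_nonzero (x.p (i + 1)).rep_nonzero,
    Projectivization.mk_rep, Projectivization.mk_rep, x.cycle]

theorem sameOrbit_of_mulVec {x y : MTilde} {N : Matrix (Fin 2) (Fin 2) K} (hN : N.det ≠ 0)
    (hf : ∀ v, br (quad y.f.1.rep (N.mulVec v)) (N.mulVec (quad x.f.1.rep v)) = 0)
    (hp : ∀ i, br (y.p i).rep (N.mulVec (x.p i).rep) = 0) : SameOrbit x y := by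
  have hmul {v : Fin 2 → K} (hv : v ≠ 0) : N.mulVec v ≠ 0 :=
    mt (Matrix.eq_zero_of_mulVec_eq_zero hN) hv
  let g := Matrix.GeneralLinearGroup.mkOfDetNeZero N hN
  have hg {v : Fin 2 → K} (hv : v ≠ 0) : Matrix.ProjGenLinGroup.mk g • Projectivization.mk K v hv =
      Projectivization.mk K (N.mulVec v) (hmul hv) := rfl
  refine ⟨.mk g, fun q ↦ ?_, fun i ↦ ?_⟩
  · conv_lhs => rw [← q.mk_rep, hg]
    rw [End2.eval.eq_def x.f, hg]
    exact (y.f.eval_mk_eq_mk_iff _ _).2 (hf _)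
  · rw [← (y.p i).mk_rep, ← (x.p i).mk_rep, hg, mk_eq_mk_iff_br_eq_zero]
    simpa only [Projectivization.mk_rep] using hp i

end OfCycle

section Normalization

variable {R F : Type*} [CommRing R] [Field F]

theorem cycBoundary_ne_zero_iff [IsDomain R] {W : Fin 5 → R} :
    cycBoundary W ≠ 0 ↔ (∀ i, W i ≠ 0) ∧ cycY W ≠ 0 := by
  rw [cycBoundary, mul_ne_zero_iff, Finset.prod_ne_zero_iff]
  simp only [Finset.mem_univ, true_imp_iff]

theorem crossRatio_slicePoints {W : Fin 5 → F} (h : IsLyness W) (h0 : ∀ i, W i ≠ 0) :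
    crossRatio (slicePoints W) = W := by
  refine h.ext (isLyness_crossRatio (pairwise_br_slicePoints_ne_zero h h0)) (h0 0) (h0 1) ?_ ?_ <;>
    simp [crossRatio, slicePoints, br_vec2]

variable {W : Fin 5 → K}

/-- The normalized point of `M̃₂(5)` with cross-ratios `W`. -/
def slice (W : Fin 5 → K) (h : IsLyness W) (hB : cycBoundary W ≠ 0) : MTilde :=
  have h0 := (cycBoundary_ne_zero_iff.1 hB).1
  .ofCycle (sliceQuad W) (slicePoints W)
    ((forall_quad_sliceQuad_ne_zero_iff h h0).2 (cycBoundary_ne_zero_iff.1 hB).2)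
    (pairwise_br_slicePoints_ne_zero h h0) (br_quad_sliceQuad h)

theorem lyn_slice (h : IsLyness W) (hB : cycBoundary W ≠ 0) : lyn (slice W h hB) = W := by
  choose c hc0 hc using MTilde.exists_rep_ofCycle _ _ (br_quad_sliceQuad h)
  rw [lyn]
  refine .trans ?_ (crossRatio_slicePoints h (cycBoundary_ne_zero_iff.1 hB).1)
  refine crossRatio_congr one_ne_zero hc0 fun i j ↦ ?_
  rw [slice, hc, hc, br_smul_left, br_smul_right, mul_one, mul_assoc]

/-- The linear map that sends the first, third and fourth of the five points to `1`, `∞` and `0`. -/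
def normalizer (V : Fin 5 → Fin 2 → R) : Matrix (Fin 2) (Fin 2) R :=
  !![-br (V 2) (V 0) * V 3 1, br (V 2) (V 0) * V 3 0;
    -br (V 3) (V 0) * V 2 1, br (V 3) (V 0) * V 2 0]

theorem normalizer_mulVec (V : Fin 5 → Fin 2 → R) (v : Fin 2 → R) :
    (normalizer V).mulVec v = ![br (V 2) (V 0) * br (V 3) v, br (V 3) (V 0) * br (V 2) v] := by
  refine funext (Fin.forall_fin_two.2 ⟨?_, ?_⟩) <;>
    simp only [normalizer, Matrix.mulVec, Matrix.vec2_dotProduct, br, Matrix.of_apply,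
      Matrix.cons_val] <;> ring

theorem det_normalizer_ne_zero [IsDomain R] {V : Fin 5 → Fin 2 → R}
    (hV : Pairwise fun i j ↦ br (V i) (V j) ≠ 0) : (normalizer V).det ≠ 0 := by
  have h : (normalizer V).det = br (V 3) (V 2) * br (V 2) (V 0) * br (V 3) (V 0) := by
    simp only [normalizer, Matrix.det_fin_two_of, br]
    ring
  rw [h]
  exact mul_ne_zero (mul_ne_zero (hV (by simp)) (hV (by simp))) (hV (by simp))

theorem br_slicePoints_normalizer_mulVec {V : Fin 5 → Fin 2 → F}
    (hV : Pairwise fun i j ↦ br (V i) (V j) ≠ 0) (i : Fin 5) :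
    br (slicePoints (crossRatio V) i) ((normalizer V).mulVec (V i)) = 0 := by
  have e0 := one_add_crossRatio hV 0
  have e1 := one_add_crossRatio hV 1
  simp only [mul_zero, mul_one, zero_add, Fin.reduceAdd] at e0 e1
  rw [br_swap, neg_eq_zero, normalizer_mulVec]
  fin_cases i <;>
    simp only [slicePoints, Fin.zero_eta, Fin.mk_one, Fin.reduceFinMk, Matrix.cons_val]
  · rw [br_vec2]
    ring
  · rw [br_vec2, e0, crossRatio]
    simp only [mul_zero, zero_add]
    rw [br_swap (V 2) (V 0), br_swap (V 3) (V 0), br_swap (V 3) (V 1), br_swap (V 2) (V 1)]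
    ring
  · rw [br_vec2, br_self, mul_zero, mul_zero, zero_mul, sub_zero]
  · rw [br_vec2, br_self, mul_zero, mul_zero, zero_mul, sub_zero]
  · rw [br_vec2, e1, crossRatio]
    simp only [mul_one, Fin.reduceAdd]
    rw [br_swap (V 2) (V 0)]
    ring

/-- The normalizer of the cycle of a point of `M̃₂(5)`. -/
def MTilde.normalizer (x : MTilde) : Matrix (Fin 2) (Fin 2) K :=
  PeriodFive.normalizer fun i ↦ (x.p i).rep

theorem MTilde.det_normalizer_ne_zero (x : MTilde) : x.normalizer.det ≠ 0 :=
  PeriodFive.det_normalizer_ne_zero fun _ _ ↦ x.br_ne_zero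

theorem MTilde.br_slicePoints_lyn (x : MTilde) (i : Fin 5) :
    br (slicePoints (lyn x) i) (x.normalizer.mulVec (x.p i).rep) = 0 :=
  br_slicePoints_normalizer_mulVec (fun _ _ ↦ x.br_ne_zero) i

theorem MTilde.exists_smul_sliceQuad_lyn (x : MTilde) : ∃ l : K, l ≠ 0 ∧
    ∀ v, (l • quad (sliceQuad (lyn x)) (x.normalizer.mulVec v)) =
      x.normalizer.mulVec (quad x.f.1.rep v) := by
  have hN := x.det_normalizer_ne_zero
  have hV (i : Fin 5) : x.normalizer.mulVec (x.p i).rep ≠ 0 :=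
    mt (Matrix.eq_zero_of_mulVec_eq_zero hN) (x.p i).rep_nonzero
  choose c hc using fun i ↦ (exists_smul_eq_iff_br_eq_zero (hV i)).2 (x.br_slicePoints_lyn i)
  obtain ⟨a, ha⟩ := exists_quad_mulVec_eq hN x.f.1.rep
  obtain ⟨l, hl, rfl⟩ := exists_eq_smul_sliceQuad (isLyness_lyn x) (lyn_ne_zero x)
    (forall_quad_ne_zero_of_quad_mulVec_eq hN ha x.f.2) fun i ↦ by
      rw [← hc, ← hc, quad_vec_smul, ha, br_smul_left, br_smul_right, br_mulVec, x.br_quad,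
        mul_zero, mul_zero, mul_zero]
  exact ⟨l, hl, fun v ↦ by rw [← quad_smul, ha]⟩

theorem cycBoundary_lyn_ne_zero (x : MTilde) : cycBoundary (lyn x) ≠ 0 := by
  obtain ⟨l, -, h⟩ := x.exists_smul_sliceQuad_lyn
  refine cycBoundary_ne_zero_iff.2 ⟨lyn_ne_zero x,
    (forall_quad_sliceQuad_ne_zero_iff (isLyness_lyn x) (lyn_ne_zero x)).1 ?_⟩
  have := forall_quad_ne_zero_of_quad_mulVec_eq (b := l • sliceQuad (lyn x))
    x.det_normalizer_ne_zero (fun v ↦ by rw [quad_smul, h]) x.f.2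
  exact fun v hv h0 ↦ this v hv (by rw [quad_smul, h0, smul_zero])

theorem sameOrbit_slice (x : MTilde) :
    SameOrbit x (slice (lyn x) (isLyness_lyn x) (cycBoundary_lyn_ne_zero x)) := by
  refine sameOrbit_of_mulVec x.det_normalizer_ne_zero (fun v ↦ ?_) fun i ↦ ?_
  · obtain ⟨l, -, h⟩ := x.exists_smul_sliceQuad_lyn
    obtain ⟨c, -, hc⟩ := End2.exists_rep_ofQuad (a := sliceQuad (lyn x)) _
    rw [← h, slice, MTilde.ofCycle, hc, quad_smul, br_smul_left, br_smul_right, br_self, mul_zero,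
      mul_zero]
  · obtain ⟨c, -, hc⟩ := MTilde.exists_rep_ofCycle _ _ (br_quad_sliceQuad (isLyness_lyn x)) i
    rw [slice, hc, br_smul_left, x.br_slicePoints_lyn, mul_zero]

end Normalization

/-! ### Regular functions -/

section Homogeneous

open MvPolynomial

theorem aeval_of_isWeightedHomogeneous {ι M k F : Type*} [AddCommMonoid M] [CommSemiring k]
    [CommSemiring F] [Algebra k F] {wt : ι → M} {m : M} {P : MvPolynomial ι k}
    (hP : P.IsWeightedHomogeneous wt m) (χ : Multiplicative M →* F) (x : ι → F) :
    aeval (fun c ↦ χ (.ofAdd (wt c)) * x c) P = χ (.ofAdd m) * aeval x P := by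
  rw [aeval_def, aeval_def, eval₂_eq, eval₂_eq, Finset.mul_sum]
  refine Finset.sum_congr rfl fun d hd ↦ ?_
  have hχ : ∏ c ∈ d.support, χ (.ofAdd (wt c)) ^ d c = χ (.ofAdd m) := by
    rw [← hP (mem_support_iff.1 hd), Finsupp.weight_apply, Finsupp.sum, ofAdd_sum, map_prod]
    simp only [ofAdd_nsmul, map_pow]
  simp only [mul_pow, Finset.prod_mul_distrib, hχ]
  exact mul_left_comm ..

/-- The character of the monoid of multidegrees by which rescaling the homogeneous coordinates of
the endomorphism by `a` and those of the points of the cycle by `c` acts on multihomogeneous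
polynomials. -/
def degChar (a : K) (c : Fin 5 → K) : Multiplicative (ℕ × (Fin 5 → ℕ)) →* K where
  toFun m := a ^ m.toAdd.1 * ∏ i, c i ^ m.toAdd.2 i
  map_one' := by simp
  map_mul' m n := by
    simp only [toAdd_mul, Prod.fst_add, Prod.snd_add, Pi.add_apply, pow_add,
      Finset.prod_mul_distrib]
    exact mul_mul_mul_comm ..

variable {a : K} {c : Fin 5 → K}

theorem degChar_ne_zero (ha : a ≠ 0) (hc : ∀ i, c i ≠ 0)
    (m : Multiplicative (ℕ × (Fin 5 → ℕ))) : degChar a c m ≠ 0 :=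
  mul_ne_zero (pow_ne_zero _ ha) (Finset.prod_ne_zero_iff.2 fun i _ ↦ pow_ne_zero _ (hc i))

theorem degChar_multideg_inl (j : Fin 6) : degChar a c (.ofAdd (multideg (.inl j))) = a := by
  simp [degChar, multideg]

theorem degChar_multideg_inr (q : Fin 5 × Fin 2) :
    degChar a c (.ofAdd (multideg (.inr q))) = c q.1 := by
  simp [degChar, multideg, Pi.single_apply, pow_ite]

theorem exists_aeval_coord_eq_mul {x : MTilde} {y : Coord → K}
    (hf : ∃ a ≠ 0, ∀ j, x.f.1.rep j = a * y (.inl j))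
    (hp : ∀ i, ∃ c ≠ 0, ∀ k, (x.p i).rep k = c * y (.inr (i, k))) (m : ℕ × (Fin 5 → ℕ)) :
    ∃ t : K, t ≠ 0 ∧ ∀ P : MvPolynomial Coord ℚ, P.IsWeightedHomogeneous multideg m →
      aeval x.coord P = t * aeval y P := by
  obtain ⟨a, ha0, ha⟩ := hf
  choose c hc0 hc using hp
  refine ⟨degChar a c (.ofAdd m), degChar_ne_zero ha0 hc0 _, fun P hP ↦ ?_⟩
  rw [← aeval_of_isWeightedHomogeneous hP]
  congr 2
  funext d
  rcases d with j | ⟨i, k⟩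
  · rw [degChar_multideg_inl, MTilde.coord, ha]
  · rw [degChar_multideg_inr, MTilde.coord, hc]

end Homogeneous

section CrossRatioFunctions

/-- The bracket of two points of the cycle as a polynomial in the homogeneous coordinates. -/
def brPoly (i j : Fin 5) : MvPolynomial Coord ℚ :=
  .X (.inr (i, 0)) * .X (.inr (j, 1)) - .X (.inr (i, 1)) * .X (.inr (j, 0))

theorem isWeightedHomogeneous_brPoly (i j : Fin 5) : (brPoly i j).IsWeightedHomogeneous multideg
    ((0, Pi.single i 1) + (0, Pi.single j 1)) := by
  have hX (q : Fin 5 × Fin 2) : (MvPolynomial.X (.inr q) :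
      MvPolynomial Coord ℚ).IsWeightedHomogeneous multideg (0, Pi.single q.1 1) :=
    MvPolynomial.isWeightedHomogeneous_X ℚ multideg (.inr q)
  exact Submodule.sub_mem (MvPolynomial.weightedHomogeneousSubmodule ℚ multideg _)
    ((hX (i, 0)).mul (hX (j, 1))) ((hX (i, 1)).mul (hX (j, 0)))

theorem aeval_brPoly (x : MTilde) (i j : Fin 5) :
    MvPolynomial.aeval x.coord (brPoly i j) = br (x.p i).rep (x.p j).rep := by
  simp [brPoly, br, MTilde.coord]

theorem lyn_mem_coordRingM (i : Fin 5) : (fun x ↦ lyn x i) ∈ coordRingM := by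
  refine ⟨fun x ↦ ⟨_, _, brPoly (2 * i) (2 * i + 1) * brPoly (2 * i + 2) (2 * i + 3),
    (isWeightedHomogeneous_brPoly (2 * i + 1) (2 * i + 2)).mul
      (isWeightedHomogeneous_brPoly (2 * i) (2 * i + 3)), ?_, ?_, fun y _ ↦ ?_⟩,
    fun x y h ↦ congrFun (lyn_eq_of_sameOrbit h) i⟩
  · convert (isWeightedHomogeneous_brPoly (2 * i) (2 * i + 1)).mul
      (isWeightedHomogeneous_brPoly (2 * i + 2) (2 * i + 3)) using 1
    abel
  · rw [map_mul, aeval_brPoly, aeval_brPoly]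
    exact mul_ne_zero (x.br_ne_zero (by simp)) (x.br_ne_zero (by simp))
  · simp only [map_mul, aeval_brPoly]
    rfl

theorem inv_mem_coordRingM {h : MTilde → K} (H : h ∈ coordRingM) (h0 : ∀ x, h x ≠ 0) :
    h⁻¹ ∈ coordRingM := by
  refine ⟨fun x ↦ ?_, fun x y r ↦ congrArg (·⁻¹) (H.2 x y r)⟩
  obtain ⟨m, P, Q, hP, hQ, hx, hPQ⟩ := H.1 x
  refine ⟨m + m, Q * Q, P * Q, hQ.mul hQ, hP.mul hQ, ?_, fun y hy ↦ ?_⟩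
  · have hx0 := h0 x
    rw [hPQ x hx] at hx0
    rw [map_mul]
    exact mul_ne_zero (div_ne_zero_iff.1 hx0).1 hx
  · rw [map_mul] at hy
    have hQy := right_ne_zero_of_mul hy
    rw [Pi.inv_apply, hPQ y hQy, map_mul, map_mul, mul_div_mul_right _ _ hQy, inv_div]

end CrossRatioFunctions

section RegularFunctions

open MvPolynomial

section SliceCoord

variable {A L F : Type*} [CommRing A] [CommRing L] [FunLike F A L] [RingHomClass F A L] (f : F)
  {W : Fin 5 → A}

/-- Homogeneous coordinates of `slice W`. -/
def sliceCoord {R : Type*} [CommRing R] (W : Fin 5 → R) : Coord → R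
  | .inl j => sliceQuad W j
  | .inr (i, k) => slicePoints W i k

theorem map_sliceCoord : f ∘ sliceCoord W = sliceCoord (f ∘ W) := by
  funext d
  rcases d with j | ⟨i, k⟩
  · fin_cases j <;> simp [sliceCoord, sliceQuad]
  · fin_cases i <;> fin_cases k <;> simp [sliceCoord, slicePoints]

theorem map_cycBoundary : f (cycBoundary W) = cycBoundary (f ∘ W) := by
  simp only [cycBoundary, map_mul, map_prod, map_cycY, Function.comp_apply]

end SliceCoord

theorem aeval_comp_X {R A σ : Type*} [CommSemiring R] [CommSemiring A] [Algebra R A] (x : σ → A) :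
    aeval x ∘ (X : σ → MvPolynomial σ R) = x :=
  _root_.funext fun i ↦ aeval_X x i

theorem aeval_aeval_sliceCoord_X (W : Fin 5 → K) (P : MvPolynomial Coord ℚ) :
    aeval W (aeval (sliceCoord (X : Fin 5 → MvPolynomial (Fin 5) ℚ)) P) =
      aeval (sliceCoord W) P := by
  rw [← AlgHom.comp_apply, comp_aeval]
  exact congrArg (fun y : Coord → K ↦ aeval y P)
    ((map_sliceCoord (aeval (R := ℚ) W)).trans (by rw [aeval_comp_X]))

theorem aeval_cycBoundary_X (W : Fin 5 → K) :
    aeval W (cycBoundary (X : Fin 5 → MvPolynomial (Fin 5) ℚ)) = cycBoundary W := by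
  rw [map_cycBoundary, aeval_comp_X]

theorem exists_aeval_coord_slice {W : Fin 5 → K} (hW : IsLyness W) (hB : cycBoundary W ≠ 0)
    (m : ℕ × (Fin 5 → ℕ)) : ∃ t : K, t ≠ 0 ∧ ∀ P : MvPolynomial Coord ℚ,
      P.IsWeightedHomogeneous multideg m →
        aeval (slice W hW hB).coord P = t * aeval (sliceCoord W) P := by
  have h0 := (cycBoundary_ne_zero_iff.1 hB).1
  have hV := pairwise_br_slicePoints_ne_zero hW h0
  have hQ := (forall_quad_sliceQuad_ne_zero_iff hW h0).2 (cycBoundary_ne_zero_iff.1 hB).2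
  refine exists_aeval_coord_eq_mul (x := slice W hW hB) ?_ (fun i ↦ ?_) m
  · obtain ⟨c, hc0, hc⟩ := End2.exists_rep_ofQuad hQ
    exact ⟨c, hc0, congrFun hc⟩
  · obtain ⟨c, hc0, hc⟩ := MTilde.exists_rep_ofCycle hQ hV (br_quad_sliceQuad hW) i
    exact ⟨c, hc0, congrFun hc⟩

/-- The ideal of denominators of `h` as a function of the cross-ratios. -/
def denomIdeal (h : MTilde → K) : Ideal (MvPolynomial (Fin 5) ℚ) where
  carrier := {r | ∃ P : MvPolynomial (Fin 5) ℚ, ∀ (W : Fin 5 → K) (hW : IsLyness W)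
    (hB : cycBoundary W ≠ 0), aeval W r * h (slice W hW hB) = aeval W P}
  add_mem' := by
    rintro r₁ r₂ ⟨P₁, h₁⟩ ⟨P₂, h₂⟩
    exact ⟨P₁ + P₂, fun W hW hB ↦ by rw [map_add, map_add, add_mul, h₁, h₂]⟩
  zero_mem' := ⟨0, fun W hW hB ↦ by rw [map_zero, zero_mul]⟩
  smul_mem' := by
    rintro r₁ r₂ ⟨P, h⟩
    exact ⟨r₁ * P, fun W hW hB ↦ by rw [smul_eq_mul, map_mul, map_mul, mul_assoc, h]⟩

theorem isLyness_of_mem_zeroLocus_denomIdeal {h : MTilde → K} {W : Fin 5 → K}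
    (hW : W ∈ zeroLocus K (denomIdeal h)) : IsLyness W := fun i ↦ by
  have := hW (X i * X (i + 2) - (1 + X (i + 1))) ⟨0, fun V hV _ ↦ by simp [hV i]⟩
  simpa [sub_eq_zero] using this

theorem exists_mem_denomIdeal_aeval_ne_zero {h : MTilde → K} (H : h ∈ coordRingM) {W : Fin 5 → K}
    (hW : IsLyness W) (hB : cycBoundary W ≠ 0) : ∃ r ∈ denomIdeal h, aeval W r ≠ 0 := by
  obtain ⟨m, P, Q, hP, hQ, hx, hPQ⟩ := H.1 (slice W hW hB)
  obtain ⟨a, -, ha⟩ := exists_aeval_coord_slice hW hB m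
  rw [ha Q hQ] at hx
  have hQW := right_ne_zero_of_mul hx
  refine ⟨aeval (sliceCoord X) (Q * Q), ⟨aeval (sliceCoord X) (Q * P), fun V hV hBV ↦ ?_⟩, ?_⟩
  · simp only [aeval_aeval_sliceCoord_X, map_mul]
    by_cases hQV : aeval (sliceCoord V) Q = 0
    · simp only [hQV, zero_mul]
    · obtain ⟨b, hb0, hb⟩ := exists_aeval_coord_slice hV hBV m
      rw [hPQ _ (by rw [hb Q hQ]; exact mul_ne_zero hb0 hQV), hb Q hQ, hb P hP]
      field_simp
  · rw [aeval_aeval_sliceCoord_X, map_mul]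
    exact mul_ne_zero hQW hQW

theorem exists_cycBoundary_pow_mul_eq {h : MTilde → K} (H : h ∈ coordRingM) :
    ∃ (n : ℕ) (P : MvPolynomial (Fin 5) ℚ), ∀ x : MTilde,
      cycBoundary (lyn x) ^ n * h x = aeval (lyn x) P := by
  -- By the Nullstellensatz, the local denominators need only have no common zero off the boundary.
  have hmem : cycBoundary X ∈ (denomIdeal h).radical := by
    rw [← vanishingIdeal_zeroLocus_eq_radical (K := K)]
    intro W hW
    rw [aeval_cycBoundary_X]
    by_contra hB
    obtain ⟨r, hr, hr0⟩ :=
      exists_mem_denomIdeal_aeval_ne_zero H (isLyness_of_mem_zeroLocus_denomIdeal hW) hB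
    exact hr0 (hW r hr)
  obtain ⟨n, P, hn⟩ := hmem
  refine ⟨n, P, fun x ↦ ?_⟩
  rw [H.2 _ _ (sameOrbit_slice x), ← hn _ (isLyness_lyn x), map_pow, aeval_cycBoundary_X]

end RegularFunctions

section Independence

open MvPolynomial

theorem eq_zero_of_forall_aeval_eq_zero {σ k F : Type*} [Field k] [Field F] [Infinite F]
    [Algebra k F] {P D : MvPolynomial σ k} (hD : D ≠ 0)
    (hP : ∀ t : σ → F, aeval t D ≠ 0 → aeval t P = 0) : P = 0 := by
  have hmul : D * P = 0 := by
    refine map_injective _ (algebraMap k F).injective (MvPolynomial.funext fun t ↦ ?_)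
    rw [map_zero, map_zero, eval_map, ← aeval_def, map_mul, mul_eq_zero]
    exact or_iff_not_imp_left.2 (hP t)
  exact (mul_eq_zero.1 hmul).resolve_left hD

/-- The Lyness cycle with given first two members. -/
def lynessOf {F : Type*} [Field F] (x y : F) : Fin 5 → F :=
  ![x, y, (1 + y) / x, (1 + x + y) / (x * y), (1 + x) / y]

/-- The numerator of `cycBoundary (lynessOf x y)`, whose denominator is `(x * y) ^ 5`. -/
def boundaryNum {R : Type*} [CommRing R] (x y : R) : R :=
  x * y * (1 + x) * (1 + y) * (1 + x + y) * (x - y) * (x * y - 1 - y) * (y ^ 2 - 1 - x) *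
    (1 + y - x ^ 2) * (1 + x - x * y)

theorem map_boundaryNum {A L F : Type*} [CommRing A] [CommRing L] [FunLike F A L]
    [RingHomClass F A L] (f : F) (x y : A) : f (boundaryNum x y) = boundaryNum (f x) (f y) := by
  simp only [boundaryNum, map_mul, map_add, map_sub, map_pow, map_one]

variable {F : Type*} [Field F] {x y : F}

theorem isLyness_lynessOf (hx : x ≠ 0) (hy : y ≠ 0) : IsLyness (lynessOf x y) := fun i ↦ by
  fin_cases i <;>
    simp only [lynessOf, Fin.zero_eta, Fin.mk_one, Fin.reduceFinMk, Fin.reduceAdd, zero_add,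
      Matrix.cons_val] <;>
    field_simp <;> ring

theorem mul_pow_mul_cycBoundary_lynessOf (hx : x ≠ 0) (hy : y ≠ 0) :
    (x * y) ^ 5 * cycBoundary (lynessOf x y) = boundaryNum x y := by
  simp only [lynessOf, cycBoundary, cycY, Fin.prod_univ_five, boundaryNum, Fin.reduceAdd,
    Matrix.cons_val]
  field_simp
  ring

theorem ne_zero_of_boundaryNum_ne_zero (h : boundaryNum x y ≠ 0) : x ≠ 0 ∧ y ≠ 0 := by
  constructor <;> rintro rfl <;> simp [boundaryNum] at h

theorem exists_lyn_eq_of_boundaryNum_ne_zero {x y : K} (h : boundaryNum x y ≠ 0) :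
    ∃ p : MTilde, lyn p = lynessOf x y := by
  obtain ⟨hx, hy⟩ := ne_zero_of_boundaryNum_ne_zero h
  rw [← mul_pow_mul_cycBoundary_lynessOf hx hy] at h
  exact ⟨_, lyn_slice (isLyness_lynessOf hx hy) (right_ne_zero_of_mul h)⟩

theorem eq_zero_of_forall_aeval_lyn {P : MvPolynomial (Fin 2) ℚ}
    (hP : ∀ p : MTilde, aeval ![lyn p 0, lyn p 1] P = 0) : P = 0 := by
  refine eq_zero_of_forall_aeval_eq_zero (F := K) (D := boundaryNum (X 0) (X 1)) (fun h0 ↦ ?_)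
    fun t ht ↦ ?_
  · have h13 := congrArg (aeval ![(1 : ℚ), 3]) h0
    norm_num [map_boundaryNum, boundaryNum] at h13
  · rw [map_boundaryNum, aeval_X, aeval_X] at ht
    obtain ⟨p, hp⟩ := exists_lyn_eq_of_boundaryNum_ne_zero ht
    have ht01 : ![lyn p 0, lyn p 1] = t := by
      rw [hp]
      exact _root_.funext (Fin.forall_fin_two.2 ⟨rfl, rfl⟩)
    exact ht01 ▸ hP p

end Independence

section CoordRing

open MvPolynomial

/-- The cross-ratio `W i` as a regular function on `M₂(5)`. -/
def lynFun (i : Fin 5) : coordRingM := ⟨fun x ↦ lyn x i, lyn_mem_coordRingM i⟩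

/-- Evaluation of functions on `M₂(5)` at the class of a point of `M̃₂(5)`. -/
def evalHom (x : MTilde) : coordRingM →ₐ[ℚ] K := (Pi.evalAlgHom ℚ (fun _ ↦ K) x).comp coordRingM.val

theorem coordRingM_ext {h g : coordRingM} (hg : ∀ x, evalHom x h = evalHom x g) : h = g :=
  Subtype.ext (_root_.funext hg)

theorem evalHom_aeval_lynFun (x : MTilde) (P : MvPolynomial (Fin 5) ℚ) :
    evalHom x (aeval lynFun P) = aeval (lyn x) P := by
  rw [← AlgHom.comp_apply, comp_aeval]
  rfl

theorem isLyness_lynFun : IsLyness lynFun := fun i ↦ coordRingM_ext fun x ↦ isLyness_lyn x i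

theorem evalHom_cycBoundary_lynFun (x : MTilde) :
    evalHom x (cycBoundary lynFun) = cycBoundary (lyn x) := map_cycBoundary _

theorem isUnit_cycBoundary_lynFun : IsUnit (cycBoundary lynFun) := by
  have h0 (x : MTilde) : (cycBoundary lynFun).1 x ≠ 0 := by
    change evalHom x (cycBoundary lynFun) ≠ 0
    rw [evalHom_cycBoundary_lynFun]
    exact cycBoundary_lyn_ne_zero x
  exact .of_mul_eq_one ⟨_, inv_mem_coordRingM (cycBoundary lynFun).2 h0⟩
    (coordRingM_ext fun x ↦ mul_inv_cancel₀ (h0 x))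

theorem exists_cycBoundary_lynFun_pow_mul_mem (h : coordRingM) :
    ∃ n : ℕ, cycBoundary lynFun ^ n * h ∈ Algebra.adjoin ℚ (Set.range lynFun) := by
  obtain ⟨n, P, hP⟩ := exists_cycBoundary_pow_mul_eq h.2
  rw [Algebra.adjoin_range_eq_range_aeval]
  refine ⟨n, P, coordRingM_ext fun x ↦ (evalHom_aeval_lynFun x P).trans ?_⟩
  rw [map_mul, map_pow, evalHom_cycBoundary_lynFun]
  exact (hP x).symm

theorem algebraicIndependent_lynFun : AlgebraicIndependent ℚ ![lynFun 0, lynFun 1] := by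
  refine algebraicIndependent_iff.2 fun P hP ↦ eq_zero_of_forall_aeval_lyn fun x ↦ ?_
  have h01 : (fun i ↦ evalHom x (![lynFun 0, lynFun 1] i)) = ![lyn x 0, lyn x 1] :=
    _root_.funext (Fin.forall_fin_two.2 ⟨rfl, rfl⟩)
  rw [← h01, ← comp_aeval, AlgHom.comp_apply, hP, map_zero]

theorem sigmaStar_lynFun (i : Fin 5) : sigmaStar (lynFun i) = lynFun (i + 3) :=
  coordRingM_ext fun x ↦ lyn_shift x i

end CoordRing

end PeriodFive

end

open AlgebraicGeometry in
/-- The surface `M₂(5) / ⟨σ₅⟩` is rational over `ℚ`: it is birational over `ℚ` to the affine plane. -/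
theorem mainTheorem9 :
    Scheme.BirationalOver PeriodFive.MQuotient.toSpecRat
      (𝔸(Fin 2; Spec (CommRingCat.of ℚ)) ↘ Spec (CommRingCat.of ℚ)) :=
  PeriodFive.isLyness_lynFun.birationalOver_equalizer PeriodFive.algebraicIndependent_lynFun
    PeriodFive.isUnit_cycBoundary_lynFun PeriodFive.exists_cycBoundary_lynFun_pow_mul_mem
    PeriodFive.sigmaStar_lynFun
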